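/- Let $N \ge 2$ be an integer and let $2 < p < 2_* := \frac{2N+2}{N-1}$. For $\varepsilon > 0$ and $u$ in the Sobolev space $H^2(\mathbb{R}^N)$ of complex-valued functions put $$q_\varepsilon(u) = \int_{\mathbb{R}^N} \bigl( |\Delta u|^2 - 2|\nabla u|^2 + (1+\varepsilon)|u|^2 \bigr)\,dx ,$$ and let $$R_\varepsilon(p) = \inf_{u \in H^2(\mathbb{R}^N)\setminus\{0\}} \frac{q_\varepsilon(u)}{\|u\|_{L^p}^2}, \qquad R_\varepsilon^{rad}(p) = \inf_{u \in H^2(\mathbb{R}^N)\setminus\{0\},\ u \text{ radial}} \frac{q_\varepsilon(u)}{\|u\|_{L^p}^2},$$ where $u$ is called radial if, up to a null set, $u(x)$ depends only on $|x|$. A ground state solution is a function $u \in H^2(\mathbb{R}^N)\setminus\{0\}$ that solves $$\Delta^2 u + 2\Delta u + (1+\varepsilon)u - |u|^{p-2}u = 0 \quad \text{in } \mathbb{R}^N$$ in the sense of distributions and at which the infimum $R_\varepsilon(p)$ is attained. Then there exists $\varepsilon_0 > 0$, depending only on $N$ and $p$, such that for every $0 < \varepsilon \le \varepsilon_0$ every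 ground state solution is nonradial, and moreover $R_\varepsilon^{rad}(p) > R_\varepsilon(p)$. -/

import Mathlib

open MeasureTheory TemperedDistribution
open scoped SchwartzMap LineDeriv Laplacian ENNReal ContDiff

namespace BiharmonicNLS

/-- Euclidean space of dimension `N`. -/
abbrev Space (N : ℕ) : Type := EuclideanSpace ℝ (Fin N)

/-- Complex-valued square integrable functions, modulo equality almost everywhere. -/
abbrev L2 (N : ℕ) : Type := Lp ℂ 2 (volume : Measure (Space N))

/-- The Sobolev space `H²(ℝᴺ)`, as a set of (classes of) square integrable functions. -/
def H2 (N : ℕ) : Set (L2 N) :=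
  {u | MemSobolev 2 2 (u : 𝓢'(Space N, ℂ))}

open Classical in
/-- The square integrable function that represents a tempered distribution, if there is one
(it is then unique), and zero otherwise. -/
noncomputable def repr {N : ℕ} (T : 𝓢'(Space N, ℂ)) : L2 N :=
  if h : ∃ f : L2 N, (f : 𝓢'(Space N, ℂ)) = T then h.choose else 0

/-- The representative of the distribution given by a function in `L²` is this function. -/
theorem repr_coe {N : ℕ} (f : L2 N) : repr (f : 𝓢'(Space N, ℂ)) = f := by
  have h : ∃ g : L2 N, (g : 𝓢'(Space N, ℂ)) = (f : 𝓢'(Space N, ℂ)) := ⟨f, rfl⟩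
  have hinj := LinearMap.ker_eq_bot.1 (MeasureTheory.Lp.ker_toTemperedDistributionCLM_eq_bot
    (F := ℂ) (μ := (volume : Measure (Space N))) (p := 2))
  unfold repr
  rw [dif_pos h]
  exact hinj h.choose_spec

/-- The weak partial derivative `∂ᵢ u`. -/
noncomputable def weakPartial {N : ℕ} (i : Fin N) (u : L2 N) : L2 N :=
  repr (∂_{EuclideanSpace.single i (1 : ℝ)} (u : 𝓢'(Space N, ℂ)))

/-- The weak Laplacian `Δ u`. -/
noncomputable def weakLaplacian {N : ℕ} (u : L2 N) : L2 N :=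
  repr (Δ (u : 𝓢'(Space N, ℂ)))

/-- On `H²` the weak partial derivatives do represent the distributional ones. -/
theorem coe_weakPartial {N : ℕ} (i : Fin N) {u : L2 N} (hu : u ∈ H2 N) :
    (weakPartial i u : 𝓢'(Space N, ℂ)) =
      ∂_{EuclideanSpace.single i (1 : ℝ)} (u : 𝓢'(Space N, ℂ)) := by
  have h0 : MemSobolev 0 2 (∂_{EuclideanSpace.single i (1 : ℝ)} (u : 𝓢'(Space N, ℂ))) :=
    (MemSobolev.lineDerivOp (m := EuclideanSpace.single i (1 : ℝ)) hu).mono (by norm_num)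
  obtain ⟨f, hf⟩ := memSobolev_zero_iff.1 h0
  rw [weakPartial, hf, repr_coe]

/-- On `H²` the weak Laplacian does represent the distributional one. -/
theorem coe_weakLaplacian {N : ℕ} {u : L2 N} (hu : u ∈ H2 N) :
    (weakLaplacian u : 𝓢'(Space N, ℂ)) = Δ (u : 𝓢'(Space N, ℂ)) := by
  have h0 : MemSobolev 0 2 (Δ (u : 𝓢'(Space N, ℂ))) :=
    (MemSobolev.laplacian hu).mono (by norm_num)
  obtain ⟨f, hf⟩ := memSobolev_zero_iff.1 h0
  rw [weakLaplacian, hf, repr_coe]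

/-- The quadratic form `q_ε(u) = ∫ |Δu|² - 2 |∇u|² + (1 + ε) |u|²`. -/
noncomputable def q {N : ℕ} (ε : ℝ) (u : L2 N) : ℝ :=
  ∫ x : Space N, (‖weakLaplacian u x‖ ^ 2 - 2 * ∑ i : Fin N, ‖weakPartial i u x‖ ^ 2
    + (1 + ε) * ‖u x‖ ^ 2)

/-- The quotient `q_ε(u) / ‖u‖_p²`. -/
noncomputable def quotient {N : ℕ} (ε p : ℝ) (u : L2 N) : ℝ :=
  q ε u / (eLpNorm u (ENNReal.ofReal p) volume).toReal ^ 2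

/-- `u` is radial: it depends on `‖x‖` only, up to a null set. -/
def IsRadial {N : ℕ} (u : L2 N) : Prop :=
  ∃ f : ℝ → ℂ, ∀ᵐ x : Space N, u x = f ‖x‖

/-- The minimal energy quotient `R_ε(p)` over `H² \ {0}`. -/
noncomputable def R (N : ℕ) (ε p : ℝ) : ℝ :=
  sInf {r | ∃ u : L2 N, u ∈ H2 N ∧ u ≠ 0 ∧ r = quotient ε p u}

/-- The minimal energy quotient over the nonzero radial functions in `H²`. -/
noncomputable def Rrad (N : ℕ) (ε p : ℝ) : ℝ :=
  sInf {r | ∃ u : L2 N, u ∈ H2 N ∧ IsRadial u ∧ u ≠ 0 ∧ r = quotient ε p u}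

/-- `u` solves `Δ²u + 2 Δu + (1 + ε) u - |u|^(p-2) u = 0` in the sense of distributions. -/
def IsSolution {N : ℕ} (ε p : ℝ) (u : L2 N) : Prop :=
  ∀ φ : Space N → ℂ, ContDiff ℝ ∞ φ → HasCompactSupport φ →
    ∫ x, u x * ((Δ (Δ φ)) x + 2 * (Δ φ) x + (1 + (ε : ℂ)) * φ x) =
      ∫ x, ((‖u x‖ ^ (p - 2) : ℝ) : ℂ) * u x * φ x

/-- Ground state solutions: nonzero solutions in `H²` at which the infimum `R_ε(p)` is attained. -/
def IsGroundState {N : ℕ} (ε p : ℝ) (u : L2 N) : Prop :=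
  u ∈ H2 N ∧ u ≠ 0 ∧ IsSolution ε p u ∧ quotient ε p u = R N ε p

end BiharmonicNLS

/-!
Write `δ = √ε`. On the Fourier side `q_ε(u) = ∫ ((|2πξ|² - 1)² + δ²) |û|²`, so the form nearly
degenerates on a sphere, and the two infima are governed by how well functions with spectrum
concentrated near this sphere can concentrate in `Lᵖ`. Both quotients are compared with powers
of `δ`.

*Upper bound for `R`* (`exists_quotient_le`). A wave packet `exp (i x₁) φ(δ x₁, √δ x')`, whose
spectrum sits in a cap of the sphere, satisfies `‖(Δ + 1) u‖ ≲ δ ‖u‖` because `exp (i x₁)` solves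
the Helmholtz equation (`laplacian_add_wavePacket`). Scaling gives a quotient of order `δ ^ β` with
`β = 2 - (N + 1) (1 / 2 - 1 / p)`.

*Lower bound for `R^rad`* (`exists_radial_quotient_ge`). The value at `x` of a radial function is
its spherical average, hence the integral of `û` against the Fourier transform of the sphere of
radius `‖x‖`. The latter decays like `(‖x‖ ‖ξ‖) ^ (-(N - 1) / 2)`, since along rays it solves the
radial Helmholtz equation (`exists_sphereMeasure_decay`). Cauchy–Schwarz with the weight
`(|2πξ|² - 1)² + δ²` then yields `|u(x)| ≤ C ‖x‖ ^ (-a) (q_ε(u) / δ) ^ (1 / 2)` for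
`(N - 2) / 2 ≤ a ≤ (N - 1) / 2` (`exists_radial_pointwise_bound`). The largest `a` is used at
infinity, the smallest at the origin, and `‖u‖_r² ≤ C q_ε(u) / δ` follows for
`2N / (N - 1) < r < 2N / (N - 2)`. Interpolation with `q_ε(u) ≥ δ² ‖u‖₂²` bounds the radial
quotient from below by a power `δ ^ α`.

When `r` is below `2_* = 2(N + 1) / (N - 1)`, then `α < β` (`radial_exponent_lt`); such
an `r` with `r ≥ p` exists exactly because `p < 2_*`. Hence `R < R^rad` for small `ε`, and a
radial ground state, whose quotient is at least `R^rad`, cannot exist.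
-/

namespace BiharmonicNLS

open scoped FourierTransform

/-! ### Decay for the radial Helmholtz equation -/

theorem hasDerivAt_const_div (c : ℝ) {r : ℝ} (hr : r ≠ 0) :
    HasDerivAt (fun r ↦ c / r) (-(c / r ^ 2)) r := by
  simp only [div_eq_mul_inv, ← mul_neg]
  exact (hasDerivAt_inv hr).const_mul c

/-- Solutions of `y'' + (2m / r) y' + y = 0` decay like `r ^ (-m)`: the energy
`r ^ (2 m) (|y|² + |y' + (m / r) y|²)` of `r ^ m y` has logarithmic derivative `O(r⁻²)`. -/
theorem exists_decay_of_radial_helmholtz (m : ℝ) (hm : 0 ≤ m) :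
    ∃ C : ℝ, 0 < C ∧ ∀ (y y' y'' : ℝ → ℂ) (M : ℝ), (∀ r, HasDerivAt y (y' r) r) →
      (∀ r, HasDerivAt y' (y'' r) r) → (∀ r, 0 < r → r * y'' r + 2 * m * y' r + r * y r = 0) →
      ‖y 1‖ ≤ M → ‖y' 1‖ ≤ M → ∀ r, 1 ≤ r → ‖y r‖ ≤ C * M * r ^ (-m) := by
  set κ : ℝ := m ^ 2 - m
  refine ⟨√((1 + (1 + m) ^ 2) * Real.exp |κ|), by positivity, ?_⟩
  intro y y' y'' M hy hy' hode hM hM' r hr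
  have hM0 : 0 ≤ M := (norm_nonneg _).trans hM
  set w : ℝ → ℂ := fun r ↦ y' r + (m / r : ℝ) * y r with hwdef
  set G : ℝ → ℝ := fun r ↦ r ^ (2 * m) * (‖y r‖ ^ 2 + ‖w r‖ ^ 2) with hG
  have hw : ∀ r, 0 < r → HasDerivAt w (-y r - (m / r : ℝ) * w r + (κ / r ^ 2 : ℝ) * y r) r := by
    intro r hr
    have h1 : HasDerivAt (fun r : ℝ ↦ ((m / r : ℝ) : ℂ)) ((-(m / r ^ 2) : ℝ) : ℂ) r := by
      refine HasDerivAt.ofReal_comp ?_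
      exact hasDerivAt_const_div m hr.ne'
    have h2 := (hy' r).add (h1.mul (hy r))
    refine h2.congr_deriv ?_
    have h3 := hode r hr
    have hrc : (r : ℂ) ≠ 0 := by exact_mod_cast hr.ne'
    have h4 : y'' r = -y r - 2 * m / r * y' r := by
      field_simp
      linear_combination h3
    rw [h4]
    simp only [hwdef, κ]
    push_cast
    field_simp
    ring
  have hGd : ∀ r, 0 < r →
      HasDerivAt G (r ^ (2 * m) * (2 * (κ / r ^ 2) * inner ℝ (w r) (y r))) r := by
    intro r hr
    have h1 : HasDerivAt (fun r : ℝ ↦ r ^ (2 * m)) (2 * m * r ^ (2 * m - 1)) r :=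
      Real.hasDerivAt_rpow_const (Or.inl hr.ne')
    have h2 := h1.mul ((hy r).norm_sq.add (hw r hr).norm_sq)
    refine h2.congr_deriv ?_
    have h5 : y' r = w r - (m / r : ℝ) • y r := by simp [hwdef]
    rw [h5, Real.rpow_sub_one hr.ne']
    simp only [← Complex.real_smul, inner_sub_right, inner_add_right, inner_smul_right,
      inner_neg_right, real_inner_self_eq_norm_sq, Pi.add_apply, real_inner_comm (w r) (y r)]
    field_simp
    ring
  have hanti : AntitoneOn (fun r ↦ G r * Real.exp (|κ| / r)) (Set.Ici 1) := by
    have hd : ∀ r, 0 < r → HasDerivAt (fun r ↦ G r * Real.exp (|κ| / r))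
        ((r ^ (2 * m) * (2 * (κ / r ^ 2) * inner ℝ (w r) (y r))) * Real.exp (|κ| / r) +
          G r * (Real.exp (|κ| / r) * (-(|κ| / r ^ 2)))) r := by
      intro r hr
      refine (hGd r hr).mul (HasDerivAt.exp ?_)
      exact hasDerivAt_const_div |κ| hr.ne'
    refine antitoneOn_of_deriv_nonpos (convex_Ici 1)
      (fun r hr ↦ (hd r (zero_lt_one.trans_le hr)).continuousAt.continuousWithinAt)
      (fun r hr ↦ ?_) (fun r hr ↦ ?_)
    · rw [interior_Ici] at hr
      exact (hd r (zero_lt_one.trans hr)).differentiableAt.differentiableWithinAt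
    · rw [interior_Ici] at hr
      have hr0 : 0 < r := zero_lt_one.trans hr
      rw [(hd r hr0).deriv]
      have h6 : 2 * (κ / r ^ 2) * inner ℝ (w r) (y r) ≤
          (|κ| / r ^ 2) * (‖y r‖ ^ 2 + ‖w r‖ ^ 2) := by
        have h7 : κ * inner ℝ (w r) (y r) ≤ |κ| * (‖w r‖ * ‖y r‖) := by
          refine (le_abs_self _).trans ?_
          rw [abs_mul]
          gcongr
          exact abs_real_inner_le_norm _ _
        have h8 : 2 * (κ * inner ℝ (w r) (y r)) ≤ |κ| * (‖y r‖ ^ 2 + ‖w r‖ ^ 2) := by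
          nlinarith [mul_nonneg (abs_nonneg κ) (sq_nonneg (‖w r‖ - ‖y r‖))]
        calc 2 * (κ / r ^ 2) * inner ℝ (w r) (y r)
            = 2 * (κ * inner ℝ (w r) (y r)) / r ^ 2 := by ring
          _ ≤ |κ| * (‖y r‖ ^ 2 + ‖w r‖ ^ 2) / r ^ 2 := by gcongr
          _ = _ := by ring
      have h9 : 0 ≤ r ^ (2 * m) * Real.exp (|κ| / r) := by positivity
      have := mul_le_mul_of_nonneg_left h6 h9
      simp only [hG]
      linarith
  have h10 := hanti (Set.mem_Ici.2 le_rfl) (Set.mem_Ici.2 hr) hr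
  have hr0 : 0 < r := zero_lt_one.trans_le hr
  have h11 : G 1 ≤ (1 + (1 + m) ^ 2) * M ^ 2 := by
    have : ‖w 1‖ ≤ (1 + m) * M := by
      calc ‖w 1‖ ≤ ‖y' 1‖ + ‖((m / 1 : ℝ) : ℂ) * y 1‖ := norm_add_le _ _
        _ = ‖y' 1‖ + m * ‖y 1‖ := by simp [abs_of_nonneg hm]
        _ ≤ M + m * M := by gcongr
        _ = _ := by ring
    simp only [hG, Real.one_rpow, one_mul]
    calc ‖y 1‖ ^ 2 + ‖w 1‖ ^ 2 ≤ M ^ 2 + ((1 + m) * M) ^ 2 := by gcongr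
      _ = _ := by ring
  have h12 : (r ^ m * ‖y r‖) ^ 2 ≤ G r * Real.exp (|κ| / r) := by
    have h13 : 1 ≤ Real.exp (|κ| / r) := Real.one_le_exp (by positivity)
    calc (r ^ m * ‖y r‖) ^ 2 = r ^ (2 * m) * ‖y r‖ ^ 2 := by
          rw [mul_pow, ← Real.rpow_natCast (r ^ m), ← Real.rpow_mul hr0.le]
          norm_num [mul_comm]
      _ ≤ G r := by simp only [hG]; gcongr; nlinarith [sq_nonneg ‖w r‖]
      _ ≤ G r * Real.exp (|κ| / r) := le_mul_of_one_le_right (by positivity) h13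
  have h14 : (r ^ m * ‖y r‖) ^ 2 ≤ (1 + (1 + m) ^ 2) * Real.exp |κ| * M ^ 2 := by
    refine h12.trans (h10.trans ?_)
    simp only [div_one]
    nlinarith [Real.exp_pos |κ|]
  have h15 : r ^ m * ‖y r‖ ≤ √((1 + (1 + m) ^ 2) * Real.exp |κ|) * M := by
    rw [← Real.sqrt_sq hM0, ← Real.sqrt_mul (by positivity)]
    exact Real.le_sqrt_of_sq_le h14
  rw [Real.rpow_neg hr0.le, ← div_eq_mul_inv, le_div_iff₀ (by positivity)]
  linarith

/-! ### The Fourier transform of the sphere -/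

/-- The uniform measure on the unit sphere of `ℝᴺ`, normalized to the volume of the unit ball:
the image of Lebesgue measure on the ball under `y ↦ y / ‖y‖`. -/
noncomputable def sphereMeasure (N : ℕ) : Measure (Space N) :=
  (volume.restrict (Metric.ball 0 1)).map (fun y ↦ ‖y‖⁻¹ • y)

theorem measurable_normalize (N : ℕ) : Measurable (fun y : Space N ↦ ‖y‖⁻¹ • y) := by
  fun_prop

instance (N : ℕ) : IsFiniteMeasure (sphereMeasure N) := by
  have : IsFiniteMeasure (volume.restrict (Metric.ball (0 : Space N) 1)) :=
    ⟨by simpa using measure_ball_lt_top⟩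
  unfold sphereMeasure
  infer_instance

theorem sphereMeasure_real_univ_pos (N : ℕ) : 0 < (sphereMeasure N).real Set.univ := by
  refine ENNReal.toReal_pos ?_ (measure_ne_top _ _)
  rw [sphereMeasure, Measure.map_apply (measurable_normalize N) .univ]
  simpa using (Metric.measure_ball_pos volume (0 : Space N) one_pos).ne'

theorem ae_norm_eq_one {N : ℕ} (hN : 1 ≤ N) : ∀ᵐ z ∂sphereMeasure N, ‖z‖ = 1 := by
  rw [sphereMeasure, ae_map_iff (measurable_normalize N).aemeasurable
    (measurableSet_eq_fun measurable_norm measurable_const)]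
  have : Nonempty (Fin N) := ⟨⟨0, hN⟩⟩
  refine ae_restrict_of_ae ?_
  filter_upwards [compl_mem_ae_iff.2 (measure_singleton (μ := volume) (0 : Space N))] with y hy
  exact norm_smul_inv_norm (𝕜 := ℝ) (by simpa using hy)

theorem measurePreserving_sphereMeasure {N : ℕ} (A : Space N ≃ₗᵢ[ℝ] Space N) :
    MeasurePreserving A (sphereMeasure N) (sphereMeasure N) := by
  refine ⟨A.continuous.measurable, ?_⟩
  have h := (A.measurePreserving.restrict_preimage
    (s := Metric.ball 0 1) Metric.isOpen_ball.measurableSet)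
  have h2 : A ⁻¹' Metric.ball 0 1 = Metric.ball 0 1 := by
    ext y; simp
  rw [h2] at h
  rw [sphereMeasure, Measure.map_map A.continuous.measurable (measurable_normalize N)]
  have h3 : A ∘ (fun y : Space N ↦ ‖y‖⁻¹ • y) = (fun y ↦ ‖y‖⁻¹ • y) ∘ A := by
    ext1 y; simp
  rw [h3, ← Measure.map_map (measurable_normalize N) A.continuous.measurable, h.map_eq]

theorem integral_sphereMeasure_comp {N : ℕ} (A : Space N ≃ₗᵢ[ℝ] Space N) (f : Space N → ℂ) :
    ∫ z, f (A z) ∂sphereMeasure N = ∫ z, f z ∂sphereMeasure N :=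
  (measurePreserving_sphereMeasure A).integral_comp A.toHomeomorph.measurableEmbedding f

/-- The rotation by the angle `θ` in the plane of two orthonormal vectors. -/
theorem exists_rotation {N : ℕ} {e f : Space N} (he : ‖e‖ = 1) (hf : ‖f‖ = 1)
    (hef : inner ℝ e f = 0) (θ : ℝ) : ∃ A : Space N ≃ₗᵢ[ℝ] Space N, ∀ z,
      inner ℝ e (A z) = Real.cos θ * inner ℝ e z - Real.sin θ * inner ℝ f z ∧
      inner ℝ f (A z) = Real.sin θ * inner ℝ e z + Real.cos θ * inner ℝ f z := by
  let L : Space N →ₗ[ℝ] Space N :=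
    { toFun z := z + ((Real.cos θ - 1) * inner ℝ e z - Real.sin θ * inner ℝ f z) • e
        + (Real.sin θ * inner ℝ e z + (Real.cos θ - 1) * inner ℝ f z) • f
      map_add' x y := by simp only [inner_add_right]; module
      map_smul' c x := by simp only [inner_smul_right, RingHom.id_apply]; module }
  have hL : ∀ z, L z = z + ((Real.cos θ - 1) * inner ℝ e z - Real.sin θ * inner ℝ f z) • e
        + (Real.sin θ * inner ℝ e z + (Real.cos θ - 1) * inner ℝ f z) • f := fun _ ↦ rfl
  have hee : inner ℝ e e = 1 := by rw [real_inner_self_eq_norm_sq, he]; norm_num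
  have hff : inner ℝ f f = 1 := by rw [real_inner_self_eq_norm_sq, hf]; norm_num
  have hfe : inner ℝ f e = 0 := by rw [real_inner_comm, hef]
  have hnorm : ∀ z, ‖L z‖ = ‖z‖ := by
    intro z
    rw [← sq_eq_sq₀ (norm_nonneg _) (norm_nonneg _), ← real_inner_self_eq_norm_sq,
      ← real_inner_self_eq_norm_sq, hL]
    simp only [inner_add_left, inner_add_right, inner_smul_left, inner_smul_right, hee, hff, hef,
      hfe, real_inner_comm e z, real_inner_comm f z, conj_trivial]
    linear_combination ((inner ℝ e z) ^ 2 + (inner ℝ f z) ^ 2) * Real.sin_sq_add_cos_sq θ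
  refine ⟨LinearIsometry.toLinearIsometryEquiv ⟨L, hnorm⟩ rfl, fun z ↦ ?_⟩
  simp only [LinearIsometry.coe_toLinearIsometryEquiv, LinearIsometry.coe_mk, hL]
  simp only [inner_add_right, inner_smul_right, hee, hff, hef, hfe]
  constructor <;> ring

theorem integrable_sphereMeasure {N : ℕ} (hN : 1 ≤ N) {f : Space N → ℂ} (hf : Continuous f) :
    Integrable f (sphereMeasure N) := by
  obtain ⟨C, hC⟩ := (isCompact_sphere (0 : Space N) 1).exists_bound_of_continuousOn hf.continuousOn
  refine Integrable.of_bound hf.aestronglyMeasurable C ?_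
  filter_upwards [ae_norm_eq_one hN] with z hz
  exact hC z (by simpa using hz)

theorem hasDerivAt_integral_sphereMeasure {N : ℕ} (hN : 1 ≤ N) {F F' : ℝ → Space N → ℂ}
    (hF : ∀ t, Continuous (F t)) (hF' : Continuous (Function.uncurry F'))
    (h : ∀ t z, HasDerivAt (fun t ↦ F t z) (F' t z) t) (t₀ : ℝ) :
    HasDerivAt (fun t ↦ ∫ z, F t z ∂sphereMeasure N) (∫ z, F' t₀ z ∂sphereMeasure N) t₀ := by
  obtain ⟨C, hC⟩ := ((isCompact_closedBall t₀ 1).prod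
    (isCompact_sphere (0 : Space N) 1)).exists_bound_of_continuousOn hF'.continuousOn
  refine (hasDerivAt_integral_of_dominated_loc_of_deriv_le (bound := fun _ ↦ C)
    (Metric.closedBall_mem_nhds t₀ one_pos) (.of_forall fun t ↦ (hF t).aestronglyMeasurable)
    (integrable_sphereMeasure hN (hF t₀))
    (hF'.comp (Continuous.prodMk_right t₀)).aestronglyMeasurable ?_ (integrable_const C)
    (.of_forall fun z t _ ↦ h t z)).2
  filter_upwards [ae_norm_eq_one hN] with z hz t ht
  exact hC (t, z) ⟨ht, by simpa using hz⟩

/-- An instance of the divergence theorem on the sphere, obtained by differentiating the invariance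
of the measure under rotations in the plane of `e` and `f`. -/
theorem integral_sphereMeasure_rotation {N : ℕ} (hN : 1 ≤ N) {e f : Space N} (he : ‖e‖ = 1)
    (hf : ‖f‖ = 1) (hef : inner ℝ e f = 0) (r : ℝ) :
    ∫ z, ((inner ℝ e z : ℝ) - Complex.I * r * (inner ℝ f z : ℝ) ^ 2) *
      Complex.exp (Complex.I * r * (inner ℝ e z : ℝ)) ∂sphereMeasure N = 0 := by
  let F : ℝ → Space N → ℂ := fun θ z ↦
    ((Real.sin θ * inner ℝ e z + Real.cos θ * inner ℝ f z : ℝ) : ℂ) *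
      Complex.exp (Complex.I * r * ((Real.cos θ * inner ℝ e z - Real.sin θ * inner ℝ f z : ℝ) : ℂ))
  let F' : ℝ → Space N → ℂ := fun θ z ↦
    ((Real.cos θ * inner ℝ e z - Real.sin θ * inner ℝ f z : ℝ) : ℂ) *
      Complex.exp (Complex.I * r * ((Real.cos θ * inner ℝ e z - Real.sin θ * inner ℝ f z : ℝ) : ℂ))
    + ((Real.sin θ * inner ℝ e z + Real.cos θ * inner ℝ f z : ℝ) : ℂ) *
      (Complex.exp (Complex.I * r *
        ((Real.cos θ * inner ℝ e z - Real.sin θ * inner ℝ f z : ℝ) : ℂ)) *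
        (Complex.I * r * ((-Real.sin θ * inner ℝ e z - Real.cos θ * inner ℝ f z : ℝ) : ℂ)))
  have h1 := hasDerivAt_integral_sphereMeasure hN (F := F) (F' := F')
    (fun t ↦ by fun_prop) (by simp only [F', Function.uncurry_def]; fun_prop) (fun t z ↦ ?_) 0
  · have h2 : ∀ θ, ∫ z, F θ z ∂sphereMeasure N = ∫ z, ((inner ℝ f z : ℝ) : ℂ) *
        Complex.exp (Complex.I * r * (inner ℝ e z : ℝ)) ∂sphereMeasure N := by
      intro θ
      obtain ⟨A, hA⟩ := exists_rotation he hf hef θ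
      refine Eq.trans ?_ (integral_sphereMeasure_comp A _)
      refine integral_congr_ae (.of_forall fun z ↦ ?_)
      simp only [F, (hA z).1, (hA z).2]
    simp only [h2] at h1
    have h3 := (hasDerivAt_const (0 : ℝ) _).unique h1
    rw [h3]
    refine integral_congr_ae (.of_forall fun z ↦ ?_)
    simp only [F', Real.sin_zero, Real.cos_zero]
    push_cast
    ring_nf
  · have ha : HasDerivAt (fun θ : ℝ ↦ Real.cos θ * inner ℝ e z - Real.sin θ * inner ℝ f z)
        (-Real.sin t * inner ℝ e z - Real.cos t * inner ℝ f z) t :=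
      ((Real.hasDerivAt_cos t).mul_const _).sub ((Real.hasDerivAt_sin t).mul_const _)
    have hb : HasDerivAt (fun θ : ℝ ↦ Real.sin θ * inner ℝ e z + Real.cos θ * inner ℝ f z)
        (Real.cos t * inner ℝ e z - Real.sin t * inner ℝ f z) t := by
      have := ((Real.hasDerivAt_sin t).mul_const (inner ℝ e z)).add
        ((Real.hasDerivAt_cos t).mul_const (inner ℝ f z))
      exact this.congr_deriv (by ring)
    exact hb.ofReal_comp.mul ((ha.ofReal_comp.const_mul _).cexp)

/-- The Fourier transform of the sphere decays like `‖x‖ ^ (-(N - 1) / 2)`, hence like every smaller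
negative power of `‖x‖`. Along a ray it solves the radial Helmholtz equation. -/
theorem exists_sphereMeasure_decay {N : ℕ} (hN : 2 ≤ N) : ∃ C : ℝ, 0 < C ∧
    ∀ (x : Space N) (a : ℝ), x ≠ 0 → 0 ≤ a → a ≤ ((N : ℝ) - 1) / 2 →
      ‖∫ z, Complex.exp (Complex.I * (inner ℝ x z : ℝ)) ∂sphereMeasure N‖ ≤ C * ‖x‖ ^ (-a) := by
  have hN1 : 1 ≤ N := by omega
  have hNr : (2 : ℝ) ≤ N := by exact_mod_cast hN
  obtain ⟨C, hC, h⟩ := exists_decay_of_radial_helmholtz (((N : ℝ) - 1) / 2) (by linarith)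
  set M := (sphereMeasure N).real Set.univ
  have hM : 0 < M := sphereMeasure_real_univ_pos N
  let i₀ : Fin N := ⟨0, by omega⟩
  let e : Fin N → Space N := fun i ↦ EuclideanSpace.single i 1
  have he : ∀ i, ‖e i‖ = 1 := fun i ↦ by simp [e]
  have hez : ∀ i (z : Space N), inner ℝ (e i) z = z i := fun i z ↦ by
    simp [e, EuclideanSpace.inner_single_left]
  let E : ℝ → Space N → ℂ := fun r z ↦ Complex.exp (Complex.I * r * (z i₀ : ℝ))
  have hEn : ∀ r z, ‖E r z‖ = 1 := by
    intro r z
    have : Complex.I * r * (z i₀ : ℝ) = ((r * z i₀ : ℝ) : ℂ) * Complex.I := by push_cast; ring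
    simp only [E, this, Complex.norm_exp_ofReal_mul_I]
  let y : ℝ → ℂ := fun r ↦ ∫ z, E r z ∂sphereMeasure N
  let y' : ℝ → ℂ := fun r ↦ ∫ z, Complex.I * (z i₀ : ℝ) * E r z ∂sphereMeasure N
  let y'' : ℝ → ℂ := fun r ↦ ∫ z, -((z i₀ : ℝ) : ℂ) ^ 2 * E r z ∂sphereMeasure N
  have hyb : ∀ r, ‖y r‖ ≤ M := by
    intro r
    refine (norm_integral_le_of_norm_le_const (C := 1) (.of_forall fun z ↦ (hEn r z).le)).trans ?_
    rw [one_mul]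
  have hy'b : ∀ r, ‖y' r‖ ≤ M := by
    intro r
    refine (norm_integral_le_of_norm_le_const (C := 1) ?_).trans (by rw [one_mul])
    filter_upwards [ae_norm_eq_one hN1] with z hz
    have := PiLp.norm_apply_le z i₀
    rw [hz] at this
    rwa [norm_mul, norm_mul, hEn, Complex.norm_I, Complex.norm_real, one_mul, mul_one]
  have hEd : ∀ r z, HasDerivAt (fun r ↦ E r z) (Complex.I * (z i₀ : ℝ) * E r z) r := by
    intro r z
    have h1 : HasDerivAt (fun r : ℝ ↦ Complex.I * r * (z i₀ : ℝ)) (Complex.I * (z i₀ : ℝ)) r := by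
      have := (((hasDerivAt_id r).ofReal_comp).const_mul Complex.I).mul_const ((z i₀ : ℝ) : ℂ)
      simpa using this
    have := h1.cexp
    rwa [mul_comm] at this
  have hEc : Continuous (Function.uncurry E) := by
    simp only [E, Function.uncurry_def]; fun_prop
  have hEc' : ∀ r, Continuous (E r) := fun r ↦ by simp only [E]; fun_prop
  have hyd : ∀ r, HasDerivAt y (y' r) r := hasDerivAt_integral_sphereMeasure hN1 hEc'
    (F' := fun r z ↦ Complex.I * (z i₀ : ℝ) * E r z)
    (by simp only [Function.uncurry_def] at hEc ⊢; fun_prop) hEd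
  have hy'd : ∀ r, HasDerivAt y' (y'' r) r := by
    refine hasDerivAt_integral_sphereMeasure hN1 (fun r ↦ ?_)
      (F' := fun r z ↦ -((z i₀ : ℝ) : ℂ) ^ 2 * E r z) ?_ ?_
    · have := hEc' r; fun_prop
    · simp only [Function.uncurry_def] at hEc ⊢; fun_prop
    · intro r z
      refine ((hEd r z).const_mul (Complex.I * (z i₀ : ℝ))).congr_deriv ?_
      linear_combination ((z i₀ : ℝ) : ℂ) ^ 2 * E r z * Complex.I_sq
  have hode : ∀ r, 0 < r → r * y'' r + 2 * ((((N : ℝ) - 1) / 2 : ℝ) : ℂ) * y' r + r * y r = 0 := by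
    intro r _
    have h1 : ∑ i ∈ Finset.univ.erase i₀, ∫ z, (((z i₀ : ℝ) : ℂ) - Complex.I * r * (z i : ℝ) ^ 2) *
        E r z ∂sphereMeasure N = 0 := by
      refine Finset.sum_eq_zero fun i hi ↦ ?_
      have hne : i ≠ i₀ := Finset.ne_of_mem_erase hi
      have := integral_sphereMeasure_rotation hN1 (he i₀) (he i)
        (by rw [hez]; simp [e, hne.symm]) r
      simpa only [hez] using this
    have hint : ∀ i, Integrable (fun z : Space N ↦ (((z i₀ : ℝ) : ℂ)
        - Complex.I * r * (z i : ℝ) ^ 2) * E r z) (sphereMeasure N) := fun i ↦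
      integrable_sphereMeasure hN1 (by have := hEc' r; fun_prop)
    rw [← integral_finsetSum _ (fun i _ ↦ hint i)] at h1
    have h2 : r * y'' r + 2 * ((((N : ℝ) - 1) / 2 : ℝ) : ℂ) * y' r + r * y r =
        ∫ z, (r * (-((z i₀ : ℝ) : ℂ) ^ 2 * E r z) + 2 * ((((N : ℝ) - 1) / 2 : ℝ) : ℂ) *
          (Complex.I * (z i₀ : ℝ) * E r z) + r * E r z) ∂sphereMeasure N := by
      have i1 : Integrable (fun z : Space N ↦ (r : ℂ) * (-((z i₀ : ℝ) : ℂ) ^ 2 * E r z))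
        (sphereMeasure N) := integrable_sphereMeasure hN1 (by have := hEc' r; fun_prop)
      have i2 : Integrable (fun z : Space N ↦ 2 * ((((N : ℝ) - 1) / 2 : ℝ) : ℂ) *
          (Complex.I * (z i₀ : ℝ) * E r z)) (sphereMeasure N) :=
        integrable_sphereMeasure hN1 (by have := hEc' r; fun_prop)
      have i3 : Integrable (fun z : Space N ↦ (r : ℂ) * E r z) (sphereMeasure N) :=
        integrable_sphereMeasure hN1 (by have := hEc' r; fun_prop)
      have e1 := integral_add (i1.add i2) i3
      simp only [Pi.add_apply] at e1
      rw [e1, integral_add i1 i2, integral_const_mul, integral_const_mul,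
        integral_const_mul]
    rw [h2]
    have h3 := congrArg (fun t ↦ Complex.I * t) h1
    simp only [mul_zero] at h3
    rw [← integral_const_mul] at h3
    rw [← h3]
    refine integral_congr_ae ?_
    filter_upwards [ae_norm_eq_one hN1] with z hz
    have h4 : ∑ i ∈ Finset.univ.erase i₀, ((z i : ℝ) : ℂ) ^ 2 = 1 - ((z i₀ : ℝ) : ℂ) ^ 2 := by
      have h5 := EuclideanSpace.real_norm_sq_eq z
      rw [hz, ← Finset.add_sum_erase _ _ (Finset.mem_univ i₀)] at h5
      have h6 : ∑ i ∈ Finset.univ.erase i₀, (z i) ^ 2 = 1 - (z i₀) ^ 2 := by linarith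
      exact_mod_cast h6
    have hcard : ((Finset.univ.erase i₀).card : ℂ) = N - 1 := by
      rw [Finset.card_erase_of_mem (Finset.mem_univ _), Finset.card_univ, Fintype.card_fin,
        Nat.cast_sub hN1, Nat.cast_one]
    rw [← Finset.sum_mul, Finset.sum_sub_distrib, ← Finset.mul_sum, h4, Finset.sum_const,
      nsmul_eq_mul, hcard]
    push_cast
    linear_combination ((r : ℂ) * (1 - ((z i₀ : ℝ) : ℂ) ^ 2) * E r z) * Complex.I_sq
  refine ⟨C * M + M, by positivity, fun x a hx ha0 ha ↦ ?_⟩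
  have hx0 : 0 < ‖x‖ := norm_pos_iff.2 hx
  have hrot : ∫ z, Complex.exp (Complex.I * (inner ℝ x z : ℝ)) ∂sphereMeasure N = y ‖x‖ := by
    set A := (Submodule.span ℝ {x - ‖x‖ • e i₀})ᗮ.reflection
    have hA : A x = ‖x‖ • e i₀ := Submodule.reflection_sub (by rw [norm_smul, he]; simp)
    rw [← integral_sphereMeasure_comp A]
    refine integral_congr_ae (.of_forall fun z ↦ ?_)
    have h1 : inner ℝ x (A z) = ‖x‖ * z i₀ := by
      rw [← hez i₀, ← real_inner_smul_left, ← hA, ← A.inner_map_map x (A z),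
        Submodule.reflection_reflection]
    simp only [h1, E]
    push_cast
    ring_nf
  rw [hrot]
  rcases le_total 1 ‖x‖ with h1 | h1
  · calc ‖y ‖x‖‖ ≤ C * M * ‖x‖ ^ (-(((N : ℝ) - 1) / 2)) :=
          h y y' y'' M hyd hy'd hode (hyb 1) (hy'b 1) ‖x‖ h1
      _ ≤ (C * M + M) * ‖x‖ ^ (-a) := by
          gcongr
          linarith
  · calc ‖y ‖x‖‖ ≤ M * 1 := by rw [mul_one]; exact hyb _
      _ ≤ (C * M + M) * ‖x‖ ^ (-a) := by
          gcongr
          · have : 0 ≤ C * M := by positivity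
            linarith
          · exact Real.one_le_rpow_of_pos_of_le_one_of_nonpos hx0 h1 (by linarith)

/-! ### Plancherel for the quadratic form -/

theorem ae_eq_of_toTemperedDistribution_eq {N : ℕ} (h : L2 N) {f : Space N → ℂ}
    (hf : LocallyIntegrable f)
    (H : ∀ φ : 𝓢(Space N, ℂ), (h : 𝓢'(Space N, ℂ)) φ = ∫ x, φ x • f x) : h =ᵐ[volume] f := by
  refine ae_eq_of_integral_contDiff_smul_eq ((Lp.memLp h).locallyIntegrable (by norm_num)) hf ?_
  intro g g_smooth g_cpt
  have hg₁ : HasCompactSupport (Complex.ofRealCLM ∘ g) := g_cpt.comp_left rfl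
  have hg₂ : ContDiff ℝ ∞ (Complex.ofRealCLM ∘ g) := by fun_prop
  simpa using H (hg₁.toSchwartzMap hg₂)

theorem ae_eq_of_smulLeftCLM_eq {N : ℕ} {f h : L2 N} {g : Space N → ℂ}
    (hg : g.HasTemperateGrowth)
    (H : (h : 𝓢'(Space N, ℂ)) = smulLeftCLM ℂ g (f : 𝓢'(Space N, ℂ))) :
    h =ᵐ[volume] fun x ↦ g x * f x := by
  refine ae_eq_of_toTemperedDistribution_eq h ?_ fun φ ↦ ?_
  · rw [← locallyIntegrableOn_univ]
    exact ((((Lp.memLp f).locallyIntegrable (by norm_num)).locallyIntegrableOn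
      Set.univ).continuousOn_mul hg.1.continuous.continuousOn isOpen_univ.isLocallyClosed)
  · rw [H, smulLeftCLM_apply_apply, Lp.toTemperedDistribution_apply]
    refine integral_congr_ae (.of_forall fun x ↦ ?_)
    simp only [SchwartzMap.smulLeftCLM_apply_apply hg, smul_eq_mul]
    ring

theorem fourier_weakLaplacian {N : ℕ} {u : L2 N} (hu : u ∈ H2 N) :
    (𝓕 (weakLaplacian u) : L2 N) =ᵐ[volume]
      fun x ↦ ((-((2 * Real.pi) ^ 2 * ‖x‖ ^ 2) : ℝ) : ℂ) * (𝓕 u : L2 N) x := by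
  have h2 : (fun x : Space N ↦ ((‖x‖ ^ 2 : ℝ) : ℂ)).HasTemperateGrowth := by fun_prop
  refine ae_eq_of_smulLeftCLM_eq (by fun_prop) ?_
  rw [← Lp.fourier_toTemperedDistribution_eq, coe_weakLaplacian hu,
    TemperedDistribution.laplacian_eq_fourierMultiplierCLM,
    TemperedDistribution.fourierMultiplierCLM_apply, ← Lp.fourier_toTemperedDistribution_eq]
  have h1 : (fun x : Space N ↦ ((-((2 * Real.pi) ^ 2 * ‖x‖ ^ 2) : ℝ) : ℂ)) =
      (-(2 * Real.pi) ^ 2 : ℂ) • fun x : Space N ↦ ((‖x‖ ^ 2 : ℝ) : ℂ) := by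
    ext x; simp
  rw [h1, smulLeftCLM_smul h2]
  have h3 : ∀ T : 𝓢'(Space N, ℂ), (-(2 * Real.pi) ^ 2 : ℝ) • T = (-(2 * Real.pi) ^ 2 : ℂ) • T := by
    intro T
    ext φ
    simp
  rw [h3, FourierTransform.fourier_smul, FourierTransform.fourier_fourierInv_eq]
  rfl

theorem fourier_weakPartial {N : ℕ} {u : L2 N} (hu : u ∈ H2 N) (i : Fin N) :
    (𝓕 (weakPartial i u) : L2 N) =ᵐ[volume]
      fun x ↦ (2 * Real.pi * Complex.I * (x i : ℝ)) * (𝓕 u : L2 N) x := by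
  have h2 : (fun x : Space N ↦
      ((inner ℝ x (EuclideanSpace.single i (1 : ℝ)) : ℝ) : ℂ)).HasTemperateGrowth := by
    fun_prop
  have h1 : (fun x : Space N ↦ (2 * Real.pi * Complex.I * (x i : ℝ) : ℂ)) =
      (2 * Real.pi * Complex.I : ℂ) •
        fun x : Space N ↦ ((inner ℝ x (EuclideanSpace.single i (1 : ℝ)) : ℝ) : ℂ) := by
    ext x; simp [EuclideanSpace.inner_single_right]
  refine ae_eq_of_smulLeftCLM_eq (g := fun x : Space N ↦ (2 * Real.pi * Complex.I * (x i : ℝ) : ℂ))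
    (by rw [h1]; fun_prop) ?_
  rw [← Lp.fourier_toTemperedDistribution_eq, coe_weakPartial i hu,
    TemperedDistribution.lineDeriv_eq_fourierMultiplierCLM,
    TemperedDistribution.fourierMultiplierCLM_apply, ← Lp.fourier_toTemperedDistribution_eq]
  rw [h1, smulLeftCLM_smul h2, FourierTransform.fourier_smul,
    FourierTransform.fourier_fourierInv_eq]
  rfl

theorem integrable_norm_sq {N : ℕ} (f : L2 N) : Integrable (fun x ↦ ‖f x‖ ^ 2) :=
  (memLp_two_iff_integrable_sq_norm (Lp.memLp f).1).1 (Lp.memLp f)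

theorem integral_norm_sq {N : ℕ} (f : L2 N) : ∫ x, ‖f x‖ ^ 2 = ‖f‖ ^ 2 := by
  have h := L2.inner_def (𝕜 := ℂ) f f
  simp only [inner_self_eq_norm_sq_to_K] at h
  have h2 : ((‖f‖ ^ 2 : ℝ) : ℂ) = ((∫ x, ‖f x‖ ^ 2 : ℝ) : ℂ) := by
    rw [← integral_complex_ofReal]
    simpa using h
  exact_mod_cast h2.symm

/-- The symbol of `q_ε`, for the Fourier transform with kernel `exp (-2πi⟨x, ξ⟩)`. -/
noncomputable def symbol {N : ℕ} (ε : ℝ) (x : Space N) : ℝ :=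
  ((2 * Real.pi * ‖x‖) ^ 2 - 1) ^ 2 + ε

theorem integrable_symbol_and_q_eq {N : ℕ} (ε : ℝ) {u : L2 N} (hu : u ∈ H2 N) :
    Integrable (fun x ↦ symbol ε x * ‖(𝓕 u : L2 N) x‖ ^ 2) ∧
      q ε u = ∫ x, symbol ε x * ‖(𝓕 u : L2 N) x‖ ^ 2 := by
  set D := weakLaplacian u
  have hsum : ∫ x : Space N, (‖D x‖ ^ 2 - 2 * ∑ i : Fin N, ‖weakPartial i u x‖ ^ 2
      + (1 + ε) * ‖u x‖ ^ 2) = ‖D‖ ^ 2 - 2 * ∑ i, ‖weakPartial i u‖ ^ 2 + (1 + ε) * ‖u‖ ^ 2 := by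
    have i1 := integrable_norm_sq D
    have i2 : Integrable (fun x : Space N ↦ 2 * ∑ i : Fin N, ‖weakPartial i u x‖ ^ 2) :=
      (integrable_finsetSum _ fun i _ ↦ integrable_norm_sq (weakPartial i u)).const_mul 2
    have i3 := (integrable_norm_sq u).const_mul (1 + ε)
    have e1 := integral_add (i1.sub i2) i3
    simp only [Pi.sub_apply] at e1
    rw [e1, integral_sub i1 i2, integral_const_mul, integral_const_mul,
      integral_finsetSum _ fun i _ ↦ integrable_norm_sq (weakPartial i u)]
    simp only [integral_norm_sq]
  have i1 := integrable_norm_sq (𝓕 D : L2 N)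
  have i2 : Integrable (fun x : Space N ↦ 2 * ∑ i : Fin N, ‖(𝓕 (weakPartial i u) : L2 N) x‖ ^ 2) :=
    (integrable_finsetSum _ fun i _ ↦ integrable_norm_sq (𝓕 (weakPartial i u) : L2 N)).const_mul 2
  have i3 := (integrable_norm_sq (𝓕 u : L2 N)).const_mul (1 + ε)
  have hae : (fun x ↦ ‖(𝓕 D : L2 N) x‖ ^ 2 - 2 * ∑ i : Fin N, ‖(𝓕 (weakPartial i u) : L2 N) x‖ ^ 2
      + (1 + ε) * ‖(𝓕 u : L2 N) x‖ ^ 2) =ᵐ[volume]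
      fun x ↦ symbol ε x * ‖(𝓕 u : L2 N) x‖ ^ 2 := by
    filter_upwards [fourier_weakLaplacian hu, ae_all_iff.2 (fourier_weakPartial hu)] with x h1 h2
    simp only [D, h1, h2, norm_mul, mul_pow, symbol, Complex.norm_real, Complex.norm_I,
      Real.norm_eq_abs, sq_abs]
    rw [← Finset.sum_mul, ← Finset.mul_sum, ← EuclideanSpace.real_norm_sq_eq]
    simp only [Complex.norm_ofNat]
    ring
  refine ⟨((i1.sub i2).add i3).congr hae, ?_⟩
  rw [← integral_congr_ae hae, q, hsum]
  have e1 := integral_add (i1.sub i2) i3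
  simp only [Pi.sub_apply] at e1
  rw [e1, integral_sub i1 i2, integral_const_mul, integral_const_mul,
      integral_finsetSum _ fun i _ ↦ integrable_norm_sq (𝓕 (weakPartial i u) : L2 N)]
  simp only [integral_norm_sq, Lp.norm_fourier_eq]

theorem q_nonneg {N : ℕ} {ε : ℝ} (hε : 0 ≤ ε) {u : L2 N} (hu : u ∈ H2 N) : 0 ≤ q ε u := by
  rw [(integrable_symbol_and_q_eq ε hu).2]
  exact integral_nonneg fun x ↦ by unfold symbol; positivity

/-- Completing the square: `q_ε(u) = ‖Δu + u‖² + ε ‖u‖²`. -/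
theorem q_eq_norm_sq {N : ℕ} (ε : ℝ) {u : L2 N} (hu : u ∈ H2 N) :
    q ε u = ‖weakLaplacian u + u‖ ^ 2 + ε * ‖u‖ ^ 2 := by
  rw [(integrable_symbol_and_q_eq ε hu).2, ← Lp.norm_fourier_eq u,
    ← Lp.norm_fourier_eq (weakLaplacian u + u), ← integral_norm_sq, ← integral_norm_sq,
    ← integral_const_mul, ← integral_add (integrable_norm_sq _)
      ((integrable_norm_sq _).const_mul ε)]
  refine integral_congr_ae ?_
  rw [FourierTransform.fourier_add]
  filter_upwards [fourier_weakLaplacian hu, Lp.coeFn_add (𝓕 (weakLaplacian u) : L2 N) (𝓕 u)]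
    with x h1 h2
  have h3 : ((-((2 * Real.pi) ^ 2 * ‖x‖ ^ 2) : ℝ) : ℂ) * (𝓕 u : L2 N) x + (𝓕 u : L2 N) x =
      ((1 - ((2 * Real.pi) ^ 2 * ‖x‖ ^ 2) : ℝ) : ℂ) * (𝓕 u : L2 N) x := by
    push_cast; ring
  rw [h2, Pi.add_apply, h1, h3, norm_mul, mul_pow, Complex.norm_real, Real.norm_eq_abs, sq_abs,
    symbol]
  ring

/-! ### Fourier inversion and isometries on `L²` -/

theorem fourierInv_ae_eq {N : ℕ} (f : L2 N) (hf : Integrable f) :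
    (𝓕⁻ f : L2 N) =ᵐ[volume] 𝓕⁻ (f : Space N → ℂ) := by
  have hc : Continuous (𝓕⁻ (f : Space N → ℂ)) :=
    VectorFourier.fourierIntegral_continuous Real.continuous_fourierChar (L := -innerₗ (Space N))
      ((continuous_inner (𝕜 := ℝ) (E := Space N)).neg) hf
  refine ae_eq_of_toTemperedDistribution_eq _ hc.locallyIntegrable fun φ ↦ ?_
  rw [← Lp.fourierInv_toTemperedDistribution_eq, TemperedDistribution.fourierInv_apply,
    Lp.toTemperedDistribution_apply]
  have h := VectorFourier.integral_fourierIntegral_smul_eq_flip (L := -innerₗ (Space N))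
    (μ := volume) (ν := volume) (f := (φ : Space N → ℂ)) (g := f) Real.continuous_fourierChar
    ((continuous_inner (𝕜 := ℝ) (E := Space N)).neg) φ.integrable hf
  rw [SchwartzMap.fourierInv_coe]
  refine h.trans ?_
  refine integral_congr_ae (.of_forall fun x ↦ ?_)
  simp only
  congr 2
  ext a b
  simp [real_inner_comm]

theorem fourier_compMeasurePreserving {N : ℕ} (A : Space N ≃ₗᵢ[ℝ] Space N) (f : L2 N) :
    (𝓕 (Lp.compMeasurePreserving A A.measurePreserving f) : L2 N) =
      Lp.compMeasurePreserving A A.measurePreserving (𝓕 f : L2 N) := by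
  refine DenseRange.induction_on (SchwartzMap.denseRange_toLpCLM (E := Space N) (F := ℂ) (p := 2)
    ENNReal.ofNat_ne_top) f (isClosed_eq ?_ ?_) fun φ ↦ ?_
  · exact (Lp.fourierTransformₗᵢ (Space N) ℂ).continuous.comp
      (Lp.isometry_compMeasurePreserving A.measurePreserving).continuous
  · exact (Lp.isometry_compMeasurePreserving A.measurePreserving).continuous.comp
      (Lp.fourierTransformₗᵢ (Space N) ℂ).continuous
  · have h1 : Lp.compMeasurePreserving A A.measurePreserving (φ.toLp 2) =
        (SchwartzMap.compCLMOfContinuousLinearEquiv ℂ A.toContinuousLinearEquiv φ).toLp 2 := rfl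
    have h2 : Lp.compMeasurePreserving A A.measurePreserving ((𝓕 φ).toLp 2) =
        (SchwartzMap.compCLMOfContinuousLinearEquiv ℂ A.toContinuousLinearEquiv (𝓕 φ)).toLp 2 := rfl
    rw [SchwartzMap.toLpCLM_apply, h1, SchwartzMap.toLp_fourier_eq, SchwartzMap.toLp_fourier_eq, h2]
    congr 1
    ext x
    exact Real.fourier_comp_linearIsometry A φ x

/-! ### Pointwise decay of radial functions -/

theorem integral_inv_sq_add_sq {δ : ℝ} (hδ : 0 < δ) :
    Integrable (fun t : ℝ ↦ 2 / ((2 * Real.pi * t - 1) ^ 2 + δ ^ 2)) ∧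
      ∫ t : ℝ, 2 / ((2 * Real.pi * t - 1) ^ 2 + δ ^ 2) = 1 / δ := by
  have hpi := Real.pi_pos
  have hne : 2 * Real.pi / δ ≠ 0 := by positivity
  have h : (fun t : ℝ ↦ 2 / ((2 * Real.pi * t - 1) ^ 2 + δ ^ 2)) = fun t ↦ (2 / δ ^ 2) *
      (fun s ↦ (fun r : ℝ ↦ (1 + r ^ 2)⁻¹) (s - 1 / δ)) (2 * Real.pi / δ * t) := by
    ext t
    have : 0 < 1 + (2 * Real.pi / δ * t - 1 / δ) ^ 2 := by positivity
    field_simp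
    ring
  rw [h]
  constructor
  · exact (((integrable_inv_one_add_sq.comp_sub_right (1 / δ)).comp_mul_left' hne).const_mul _)
  · rw [integral_const_mul, Measure.integral_comp_mul_left
        (fun s ↦ (fun r : ℝ ↦ (1 + r ^ 2)⁻¹) (s - 1 / δ)),
      integral_sub_right_eq_self (fun r : ℝ ↦ (1 + r ^ 2)⁻¹), integral_univ_inv_one_add_sq,
      abs_of_pos (by positivity), smul_eq_mul]
    field_simp

theorem symbol_pos {N : ℕ} {ε : ℝ} (hε : 0 < ε) (x : Space N) : 0 < symbol ε x := by
  unfold symbol; positivity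

/-- The weighted integral that carries the loss `δ⁻¹`: in polar coordinates the weight is at most
linear, and `1 / ((ρ² - 1)² + δ²)` has mass of order `1 / δ`. -/
theorem integral_rpow_div_symbol_le {N : ℕ} (hN : 2 ≤ N) {a δ : ℝ} (ha : (N : ℝ) - 2 ≤ 2 * a)
    (ha' : 2 * a ≤ (N : ℝ) - 1) (hδ : 0 < δ) (hδ1 : δ ≤ 1) :
    Integrable (fun x : Space N ↦ ‖x‖ ^ (-(2 * a)) / symbol (δ ^ 2) x) ∧
      ∫ x : Space N, ‖x‖ ^ (-(2 * a)) / symbol (δ ^ 2) x ≤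
        N * volume.real (Metric.ball (0 : Space N) 1) / δ := by
  have : Nonempty (Fin N) := ⟨⟨0, by omega⟩⟩
  have hpi := Real.pi_gt_three
  set f : ℝ → ℝ := fun ρ ↦ ρ ^ (-(2 * a)) / (((2 * Real.pi * ρ) ^ 2 - 1) ^ 2 + δ ^ 2) with hf
  have hfd : (fun x : Space N ↦ ‖x‖ ^ (-(2 * a)) / symbol (δ ^ 2) x) = fun x ↦ f ‖x‖ := rfl
  have hdim : Module.finrank ℝ (Space N) = N := by simp
  obtain ⟨hi, hint⟩ := integral_inv_sq_add_sq hδ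
  have hfm : Measurable f := by fun_prop
  have hbound : ∀ ρ ∈ Set.Ioi (0 : ℝ), 0 ≤ ρ ^ (N - 1) • f ρ ∧
      ρ ^ (N - 1) • f ρ ≤ 2 / ((2 * Real.pi * ρ - 1) ^ 2 + δ ^ 2) := by
    intro ρ (hρ : 0 < ρ)
    refine ⟨by simp only [hf, smul_eq_mul]; positivity, ?_⟩
    have h1 : ρ ^ (N - 1) • f ρ =
        ρ ^ ((N : ℝ) - 1 - 2 * a) / (((2 * Real.pi * ρ) ^ 2 - 1) ^ 2 + δ ^ 2) := by
      rw [smul_eq_mul, hf, ← mul_div_assoc, ← Real.rpow_natCast, ← Real.rpow_add hρ,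
        Nat.cast_sub (by omega)]
      simp [sub_eq_add_neg]
    set t := 2 * Real.pi * ρ with ht
    have ht0 : 0 < t := by positivity
    have hρt : ρ ≤ t := by nlinarith
    have h2 : ρ ^ ((N : ℝ) - 1 - 2 * a) ≤ max 1 t := by
      rcases le_total ρ 1 with h | h
      · exact (Real.rpow_le_one hρ.le h (by linarith)).trans (le_max_left _ _)
      · refine le_trans ?_ (hρt.trans (le_max_right _ _))
        simpa using Real.rpow_le_rpow_of_exponent_le h
          (show (N : ℝ) - 1 - 2 * a ≤ 1 by linarith)
    rw [h1, div_le_div_iff₀ (by positivity) (by positivity)]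
    have h3 : max 1 t * ((t - 1) ^ 2 + δ ^ 2) ≤ 2 * ((t ^ 2 - 1) ^ 2 + δ ^ 2) := by
      have h4 : (t ^ 2 - 1) ^ 2 = (t - 1) ^ 2 * (t + 1) ^ 2 := by ring
      have h5 : δ ^ 2 ≤ 1 := by nlinarith
      rw [h4]
      rcases max_cases 1 t with ⟨h, -⟩ | ⟨h, h'⟩
      · rw [h]
        nlinarith [mul_nonneg (sq_nonneg (t - 1)) (show 0 ≤ (t + 1) ^ 2 - 1 by nlinarith),
          sq_nonneg δ, mul_nonneg (sq_nonneg (t - 1)) (sq_nonneg (t + 1))]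
      · rw [h]
        rcases le_total t 2 with h6 | h6
        · nlinarith [mul_nonneg (sq_nonneg (t - 1)) (show 0 ≤ 2 * (t + 1) ^ 2 - t by nlinarith),
            mul_nonneg (sq_nonneg δ) (show 0 ≤ 2 - t by linarith)]
        · have h7 : (t - 2) * δ ^ 2 ≤ t - 2 := by nlinarith
          have h8 : 1 ≤ 2 * (t + 1) ^ 2 - t := by nlinarith
          have h9 : t - 2 ≤ (t - 1) ^ 2 := by nlinarith
          nlinarith [mul_le_mul_of_nonneg_left h8 (sq_nonneg (t - 1))]
    calc _ ≤ max 1 t * ((t - 1) ^ 2 + δ ^ 2) := by gcongr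
      _ ≤ _ := h3
  have hion : IntegrableOn (fun ρ : ℝ ↦ ρ ^ (N - 1) • f ρ) (Set.Ioi 0) := by
    refine Integrable.mono' hi.integrableOn (by fun_prop) ?_
    filter_upwards [ae_restrict_mem measurableSet_Ioi] with ρ hρ
    rw [Real.norm_of_nonneg (hbound ρ hρ).1]
    exact (hbound ρ hρ).2
  have hion' : IntegrableOn
      (fun ρ : ℝ ↦ ρ ^ (Module.finrank ℝ (Space N) - 1) • f ρ) (Set.Ioi 0) := by
    rwa [hdim]
  rw [hfd]
  refine ⟨(integrable_fun_norm_addHaar volume).2 hion', ?_⟩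
  rw [integral_fun_norm_addHaar volume f, hdim, nsmul_eq_mul, smul_eq_mul,
    mul_div_assoc, ← mul_one_div (volume.real _)]
  gcongr
  rw [← hint]
  calc _ ≤ ∫ ρ in Set.Ioi (0 : ℝ), 2 / ((2 * Real.pi * ρ - 1) ^ 2 + δ ^ 2) :=
        setIntegral_mono_on hion hi.integrableOn measurableSet_Ioi fun ρ hρ ↦ (hbound ρ hρ).2
    _ ≤ _ := setIntegral_le_integral hi (.of_forall fun ρ ↦ by positivity)

/-- Cauchy–Schwarz against the weight. -/
theorem integral_fourier_mul_rpow_le {N : ℕ} (hN : 2 ≤ N) {a δ : ℝ} (ha : (N : ℝ) - 2 ≤ 2 * a)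
    (ha' : 2 * a ≤ (N : ℝ) - 1) (hδ : 0 < δ) (hδ1 : δ ≤ 1) {u : L2 N} (hu : u ∈ H2 N) :
    Integrable (fun x : Space N ↦ ‖(𝓕 u : L2 N) x‖ * ‖x‖ ^ (-a)) ∧
      ∫ x : Space N, ‖(𝓕 u : L2 N) x‖ * ‖x‖ ^ (-a) ≤
        √(N * volume.real (Metric.ball (0 : Space N) 1)) * √(q (δ ^ 2) u / δ) := by
  obtain ⟨hw, hwle⟩ := integral_rpow_div_symbol_le hN ha ha' hδ hδ1
  obtain ⟨hs, hq⟩ := integrable_symbol_and_q_eq (δ ^ 2) hu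
  have hpos : ∀ x : Space N, 0 < symbol (δ ^ 2) x := fun x ↦ symbol_pos (by positivity) x
  have hsm : Measurable (fun x : Space N ↦ symbol (δ ^ 2) x) := by unfold symbol; fun_prop
  set F : Space N → ℝ := fun x ↦ √(symbol (δ ^ 2) x) * ‖(𝓕 u : L2 N) x‖
  set W : Space N → ℝ := fun x ↦ ‖x‖ ^ (-a) / √(symbol (δ ^ 2) x)
  have hF2 : ∀ x, F x ^ 2 = symbol (δ ^ 2) x * ‖(𝓕 u : L2 N) x‖ ^ 2 := fun x ↦ by
    simp only [F, mul_pow, Real.sq_sqrt (hpos x).le]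
  have hW2 : ∀ x, W x ^ 2 = ‖x‖ ^ (-(2 * a)) / symbol (δ ^ 2) x := fun x ↦ by
    simp only [W, div_pow, Real.sq_sqrt (hpos x).le]
    rw [← Real.rpow_mul_natCast (norm_nonneg x)]
    ring_nf
  have hFW : ∀ x, F x * W x = ‖(𝓕 u : L2 N) x‖ * ‖x‖ ^ (-a) := fun x ↦ by
    have := Real.sqrt_pos.2 (hpos x)
    simp only [F, W]
    field_simp
  have hFm : MemLp F 2 := by
    refine (memLp_two_iff_integrable_sq ?_).2 (by simpa only [hF2] using hs)
    exact hsm.sqrt.aestronglyMeasurable.mul (Lp.aestronglyMeasurable _).norm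
  have hWm : MemLp W 2 := by
    refine (memLp_two_iff_integrable_sq ?_).2 (by simpa only [hW2] using hw)
    exact Measurable.aestronglyMeasurable (by fun_prop)
  have hint : Integrable (fun x ↦ F x * W x) := hFm.integrable_mul hWm
  simp only [hFW] at hint
  refine ⟨hint, ?_⟩
  have hcs := integral_mul_le_Lp_mul_Lq_of_nonneg (μ := volume) Real.HolderConjugate.two_two
    (f := F) (g := W) (.of_forall fun x ↦ by positivity) (.of_forall fun x ↦ by positivity)
    (by simpa using hFm) (by simpa using hWm)
  simp only [hFW, Real.rpow_two, hF2, hW2, ← hq, ← Real.sqrt_eq_rpow] at hcs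
  refine hcs.trans ?_
  rw [← Real.sqrt_mul (q_nonneg (by positivity) hu), ← Real.sqrt_mul (by positivity)]
  refine Real.sqrt_le_sqrt ?_
  calc q (δ ^ 2) u * _ ≤ q (δ ^ 2) u * (N * volume.real (Metric.ball (0 : Space N) 1) / δ) := by
        gcongr
        exact q_nonneg (by positivity) hu
    _ = _ := by ring

theorem exists_isometry_map {N : ℕ} {x y : Space N} (h : ‖x‖ = ‖y‖) :
    ∃ A : Space N ≃ₗᵢ[ℝ] Space N, A x = y :=
  ⟨(Submodule.span ℝ {x - y})ᗮ.reflection, Submodule.reflection_sub h⟩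

/-- The Fourier integral of a function invariant under isometries is controlled through its
spherical average by the decay of the Fourier transform of the sphere. -/
theorem exists_norm_fourierInv_le_of_invariant {N : ℕ} (hN : 2 ≤ N) : ∃ C : ℝ, 0 < C ∧
    ∀ (g : Space N → ℂ) (a : ℝ), Integrable g → 0 ≤ a → 2 * a ≤ (N : ℝ) - 1 →
      (∀ A : Space N ≃ₗᵢ[ℝ] Space N, g ∘ A =ᵐ[volume] g) →
      Integrable (fun v ↦ ‖g v‖ * ‖v‖ ^ (-a)) → ∀ x, x ≠ 0 →
        ‖𝓕⁻ g x‖ ≤ C * ‖x‖ ^ (-a) * ∫ v, ‖g v‖ * ‖v‖ ^ (-a) := by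
  have hN1 : 1 ≤ N := by omega
  obtain ⟨C, hC, hdecay⟩ := exists_sphereMeasure_decay hN
  set M := (sphereMeasure N).real Set.univ
  have hM : 0 < M := sphereMeasure_real_univ_pos N
  refine ⟨C / M, by positivity, fun g a hg ha0 ha hinv hga x hx ↦ ?_⟩
  have hx0 : 0 < ‖x‖ := norm_pos_iff.2 hx
  have hpi := Real.pi_gt_three
  have h1 : ∀ A : Space N ≃ₗᵢ[ℝ] Space N, 𝓕⁻ g (A x) = 𝓕⁻ g x := by
    intro A
    rw [← Real.fourierInv_comp_linearIsometry, Real.fourierInv_eq', Real.fourierInv_eq']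
    refine integral_congr_ae ?_
    filter_upwards [hinv A] with v hv
    rw [hv]
  have h2 : (M : ℂ) * 𝓕⁻ g x = ∫ z, 𝓕⁻ g (‖x‖ • z) ∂sphereMeasure N := by
    have : ∫ z, 𝓕⁻ g (‖x‖ • z) ∂sphereMeasure N = ∫ _z, 𝓕⁻ g x ∂sphereMeasure N := by
      refine integral_congr_ae ?_
      filter_upwards [ae_norm_eq_one hN1] with z hz
      obtain ⟨A, hA⟩ := exists_isometry_map (x := x) (y := ‖x‖ • z) (by simp [norm_smul, hz])
      rw [← hA, h1]
    rw [this, integral_const, Complex.real_smul]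
  have h3 : ∫ z, 𝓕⁻ g (‖x‖ • z) ∂sphereMeasure N = ∫ v, (∫ z, Complex.exp (Complex.I *
      (inner ℝ ((2 * Real.pi * ‖x‖) • v) z : ℝ)) ∂sphereMeasure N) * g v := by
    simp_rw [Real.fourierInv_eq', smul_eq_mul]
    rw [integral_integral_swap]
    · refine integral_congr_ae (.of_forall fun v ↦ ?_)
      simp only
      rw [← integral_mul_const]
      refine integral_congr_ae (.of_forall fun z ↦ ?_)
      simp only [real_inner_smul_left, real_inner_smul_right]
      congr 2
      push_cast
      ring
    · refine (hg.comp_snd (sphereMeasure N)).bdd_mul (c := 1) ?_ ?_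
      · exact Continuous.aestronglyMeasurable (by fun_prop)
      · refine .of_forall fun p ↦ ?_
        simp only [Complex.norm_exp_ofReal_mul_I, le_refl]
  have h4 : ‖(M : ℂ) * 𝓕⁻ g x‖ ≤ ∫ v, C * ‖x‖ ^ (-a) * (‖g v‖ * ‖v‖ ^ (-a)) := by
    rw [h2, h3]
    refine norm_integral_le_of_norm_le (hga.const_mul _) ?_
    have : Nonempty (Fin N) := ⟨⟨0, hN1⟩⟩
    filter_upwards [compl_mem_ae_iff.2 (measure_singleton (μ := volume) (0 : Space N))] with v hv
    have hv0 : v ≠ 0 := by simpa using hv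
    have h5 := hdecay ((2 * Real.pi * ‖x‖) • v) a
      (smul_ne_zero (by positivity) hv0) ha0 (by linarith)
    rw [norm_mul]
    have h6 : ‖(2 * Real.pi * ‖x‖) • v‖ ^ (-a) ≤ ‖x‖ ^ (-a) * ‖v‖ ^ (-a) := by
      rw [← Real.mul_rpow hx0.le (norm_nonneg v), norm_smul, Real.norm_of_nonneg (by positivity)]
      refine Real.rpow_le_rpow_of_nonpos (by positivity) ?_ (by linarith)
      gcongr
      nlinarith
    calc _ ≤ C * ‖(2 * Real.pi * ‖x‖) • v‖ ^ (-a) * ‖g v‖ := by gcongr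
      _ ≤ C * (‖x‖ ^ (-a) * ‖v‖ ^ (-a)) * ‖g v‖ := by gcongr
      _ = _ := by ring
  rw [integral_const_mul, norm_mul, Complex.norm_real, Real.norm_of_nonneg hM.le] at h4
  rw [div_mul_eq_mul_div, div_mul_eq_mul_div, le_div_iff₀ hM]
  linarith

/-- A radial function in `H²` obeys `|u(x)| ≤ C ‖x‖⁻ᵃ (q_{δ²}(u) / δ)^{1/2}` for all exponents
`(N - 2) / 2 ≤ a ≤ (N - 1) / 2`. The Fourier transform need not be integrable, so it is truncated
to balls first. -/
theorem exists_radial_pointwise_bound {N : ℕ} (hN : 2 ≤ N) : ∃ C : ℝ, 0 < C ∧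
    ∀ (δ a : ℝ) (u : L2 N), 0 < δ → δ ≤ 1 → (N : ℝ) - 2 ≤ 2 * a → 2 * a ≤ (N : ℝ) - 1 →
      u ∈ H2 N → IsRadial u → ∀ᵐ x : Space N, ‖u x‖ ≤ C * √(q (δ ^ 2) u / δ) * ‖x‖ ^ (-a) := by
  have hNr : (2 : ℝ) ≤ N := by exact_mod_cast hN
  have : Nonempty (Fin N) := ⟨⟨0, by omega⟩⟩
  obtain ⟨C, hC, hbound⟩ := exists_norm_fourierInv_le_of_invariant hN
  have hB : 0 < volume.real (Metric.ball (0 : Space N) 1) :=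
    ENNReal.toReal_pos (Metric.measure_ball_pos volume _ one_pos).ne' measure_ball_lt_top.ne
  refine ⟨C * √(N * volume.real (Metric.ball (0 : Space N) 1)), by positivity, ?_⟩
  intro δ a u hδ hδ1 ha ha' hu ⟨f, hf⟩
  obtain ⟨hi, hle⟩ := integral_fourier_mul_rpow_le hN ha ha' hδ hδ1 hu
  set v : L2 N := 𝓕 u
  have hvinv : ∀ A : Space N ≃ₗᵢ[ℝ] Space N, v ∘ A =ᵐ[volume] v := by
    intro A
    have h1 : Lp.compMeasurePreserving A A.measurePreserving u = u := by
      refine Lp.ext ((Lp.coeFn_compMeasurePreserving _ _).trans ?_)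
      filter_upwards [hf, A.measurePreserving.quasiMeasurePreserving.ae hf] with x h2 h3
      rw [Function.comp_apply, h3, h2, A.norm_map]
    have h2 := fourier_compMeasurePreserving A u
    rw [h1] at h2
    have h3 := Lp.coeFn_compMeasurePreserving v A.measurePreserving
    rw [← h2] at h3
    exact h3.symm
  let g : ℕ → Space N → ℂ := fun k ↦ (Metric.ball 0 (k : ℝ)).indicator v
  have hgm : ∀ k, MemLp (g k) 2 := fun k ↦ (Lp.memLp v).indicator measurableSet_ball
  have hgi : ∀ k, Integrable (g k) := by
    intro k
    rw [integrable_indicator_iff measurableSet_ball]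
    have : IsFiniteMeasure (volume.restrict (Metric.ball (0 : Space N) (k : ℝ))) :=
      ⟨by simpa using measure_ball_lt_top⟩
    exact ((Lp.memLp v).restrict _).integrable (by norm_num)
  have hgle : ∀ k x, ‖g k x‖ ≤ ‖v x‖ := fun k x ↦ norm_indicator_le_norm_self _ _
  let G : ℕ → L2 N := fun k ↦ (hgm k).toLp (g k)
  have hG : Filter.Tendsto (fun k ↦ (𝓕⁻ (G k) : L2 N)) Filter.atTop (nhds u) := by
    have hGv : Filter.Tendsto G Filter.atTop (nhds v) := by
      rw [tendsto_iff_norm_sub_tendsto_zero]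
      have h1 : ∀ k, ‖G k - v‖ ^ 2 = ∫ x, ‖g k x - v x‖ ^ 2 := by
        intro k
        rw [← integral_norm_sq]
        refine integral_congr_ae ?_
        filter_upwards [Lp.coeFn_sub (G k) v, (hgm k).coeFn_toLp] with x h1 h2
        rw [h1, Pi.sub_apply, h2]
      have h2 : Filter.Tendsto (fun k ↦ ‖G k - v‖ ^ 2) Filter.atTop (nhds 0) := by
        simp only [h1]
        have h3 : (0 : ℝ) = ∫ _x : Space N, (0 : ℝ) := by simp
        rw [h3]
        refine tendsto_integral_of_dominated_convergence (fun x ↦ ‖v x‖ ^ 2)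
          (fun k ↦ ((hgm k).1.sub (Lp.aestronglyMeasurable v)).norm.pow 2)
          (integrable_norm_sq v) ?_ ?_
        · refine fun k ↦ .of_forall fun x ↦ ?_
          rw [Real.norm_of_nonneg (by positivity)]
          gcongr
          simp only [g, Set.indicator]
          split_ifs <;> simp
        · refine .of_forall fun x ↦ tendsto_const_nhds.congr' ?_
          filter_upwards [Filter.eventually_gt_atTop ⌈‖x‖⌉₊] with k hk
          have h4 : x ∈ Metric.ball (0 : Space N) (k : ℝ) := by
            rw [mem_ball_zero_iff]
            exact (Nat.le_ceil _).trans_lt (by exact_mod_cast hk)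
          simp [g, h4]
      have h4 := h2.sqrt
      simpa using h4
    have h5 : (𝓕⁻ v : L2 N) = u := FourierTransform.fourierInv_fourier_eq u
    rw [← h5]
    exact ((Lp.fourierTransformₗᵢ (Space N) ℂ).symm.continuous.tendsto v).comp hGv
  obtain ⟨ns, -, hns⟩ := (tendstoInMeasure_of_tendsto_Lp hG).exists_seq_tendsto_ae
  have hkb : ∀ k, ∀ᵐ x : Space N, ‖(𝓕⁻ (G k) : L2 N) x‖ ≤
      C * √(N * volume.real (Metric.ball (0 : Space N) 1)) * √(q (δ ^ 2) u / δ) * ‖x‖ ^ (-a) := by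
    intro k
    have hGg : (G k : Space N → ℂ) =ᵐ[volume] g k := (hgm k).coeFn_toLp
    filter_upwards [fourierInv_ae_eq (G k) ((hgi k).congr hGg.symm),
      compl_mem_ae_iff.2 (measure_singleton (μ := volume) (0 : Space N))] with x h1 h2
    have hx : x ≠ 0 := by simpa using h2
    have h3 : 𝓕⁻ (G k : Space N → ℂ) x = 𝓕⁻ (g k) x := by
      rw [Real.fourierInv_eq', Real.fourierInv_eq']
      refine integral_congr_ae ?_
      filter_upwards [hGg] with y hy
      rw [hy]
    rw [h1, h3]
    have hgw : Integrable (fun v ↦ ‖g k v‖ * ‖v‖ ^ (-a)) := by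
      refine hi.mono' ((hgi k).1.norm.mul (Measurable.aestronglyMeasurable (by fun_prop))) ?_
      refine .of_forall fun x ↦ ?_
      rw [Real.norm_of_nonneg (by positivity)]
      gcongr
      exact hgle k x
    have h4 := hbound (g k) a (hgi k) (by linarith) ha' (fun A ↦ ?_) hgw x hx
    · calc _ ≤ C * ‖x‖ ^ (-a) * ∫ v, ‖g k v‖ * ‖v‖ ^ (-a) := h4
        _ ≤ C * ‖x‖ ^ (-a) * (√(N * volume.real (Metric.ball (0 : Space N) 1)) *
            √(q (δ ^ 2) u / δ)) := by
          gcongr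
          refine le_trans (integral_mono hgw hi fun x ↦ ?_) hle
          simp only
          gcongr
          exact hgle k x
        _ = _ := by ring
    · filter_upwards [hvinv A] with y hy
      have h5 : A y ∈ Metric.ball (0 : Space N) (k : ℝ) ↔
          y ∈ Metric.ball (0 : Space N) (k : ℝ) := by
        simp
      by_cases hyk : y ∈ Metric.ball (0 : Space N) (k : ℝ)
      · simpa [g, Set.indicator_of_mem, h5.2 hyk, hyk] using hy
      · simp [g, Set.indicator_of_notMem, mt h5.1 hyk, hyk]
  filter_upwards [hns, ae_all_iff.2 hkb] with x h1 h2
  exact le_of_tendsto h1.norm (.of_forall fun k ↦ h2 (ns k))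

/-! ### Lower bound for radial functions -/

theorem toReal_eLpNorm_rpow {N : ℕ} {p : ℝ} (hp : 0 < p) {f : Space N → ℂ}
    (hf : MemLp f (ENNReal.ofReal p)) :
    (eLpNorm f (ENNReal.ofReal p) volume).toReal ^ p = ∫ x, ‖f x‖ ^ p := by
  have h0 : 0 ≤ ∫ x, ‖f x‖ ^ p := integral_nonneg fun x ↦ by positivity
  rw [hf.eLpNorm_eq_integral_rpow_norm (by simpa using hp) ENNReal.ofReal_ne_top,
    ENNReal.toReal_ofReal hp.le, ENNReal.toReal_ofReal (by positivity), ← Real.rpow_mul h0,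
    inv_mul_cancel₀ hp.ne', Real.rpow_one]

theorem memLp_ofReal_iff {N : ℕ} {E : Type*} [NormedAddCommGroup E] {p : ℝ} (hp : 0 < p)
    {f : Space N → E} (hf : AEStronglyMeasurable f) :
    MemLp f (ENNReal.ofReal p) ↔ Integrable (fun x ↦ ‖f x‖ ^ p) := by
  rw [← integrable_norm_rpow_iff hf (by simpa using hp) ENNReal.ofReal_ne_top,
    ENNReal.toReal_ofReal hp.le]

/-- The radial weight `min (‖x‖ ^ (-(N - 2) / 2)) (‖x‖ ^ (-(N - 1) / 2))` is in `Lʳ` for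
`2N / (N - 1) < r < 2N / (N - 2)`. -/
theorem memLp_min_rpow {N : ℕ} (hN : 2 ≤ N) {r : ℝ} (hr : 0 < r)
    (hr1 : 2 * (N : ℝ) < r * ((N : ℝ) - 1)) (hr2 : r * ((N : ℝ) - 2) < 2 * (N : ℝ)) :
    MemLp (fun x : Space N ↦ min (‖x‖ ^ (-(((N : ℝ) - 2) / 2))) (‖x‖ ^ (-(((N : ℝ) - 1) / 2))))
      (ENNReal.ofReal r) := by
  have : Nonempty (Fin N) := ⟨⟨0, by omega⟩⟩
  rw [memLp_ofReal_iff hr (Measurable.aestronglyMeasurable (by fun_prop))]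
  set f : ℝ → ℝ := fun y ↦ ‖min (y ^ (-(((N : ℝ) - 2) / 2))) (y ^ (-(((N : ℝ) - 1) / 2)))‖ ^ r
    with hf
  have hdim : Module.finrank ℝ (Space N) = N := by simp
  refine (integrable_fun_norm_addHaar (f := f) volume).2 ?_
  rw [hdim]
  have hfm : Measurable fun y : ℝ ↦ y ^ (N - 1) • f y := by fun_prop
  have hle : ∀ (a : ℝ) (y : ℝ), 0 < y →
      ‖min (y ^ (-(((N : ℝ) - 2) / 2))) (y ^ (-(((N : ℝ) - 1) / 2)))‖ ≤ y ^ (-a) →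
      ‖y ^ (N - 1) • f y‖ ≤ y ^ ((N : ℝ) - 1 - a * r) := by
    intro a y hy h
    have h1 : f y ≤ y ^ (-a * r) := by
      rw [Real.rpow_mul hy.le]
      simp only [hf]
      gcongr
    have h2 : 0 ≤ f y := by simp only [hf]; positivity
    rw [smul_eq_mul, Real.norm_of_nonneg (by positivity)]
    calc y ^ (N - 1) * f y ≤ y ^ (N - 1) * y ^ (-a * r) := by gcongr
      _ = _ := by
        rw [← Real.rpow_natCast, ← Real.rpow_add hy, Nat.cast_sub (by omega)]
        congr 1
        push_cast
        ring
  rw [← Set.Ioc_union_Ioi_eq_Ioi zero_le_one]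
  refine IntegrableOn.union ?_ ?_
  · have hi : IntegrableOn (fun y : ℝ ↦ y ^ ((N : ℝ) - 1 - ((N : ℝ) - 2) / 2 * r))
        (Set.Ioc 0 1) := by
      rw [← intervalIntegrable_iff_integrableOn_Ioc_of_le zero_le_one]
      exact intervalIntegral.intervalIntegrable_rpow' (by nlinarith)
    refine hi.mono' hfm.aestronglyMeasurable ?_
    filter_upwards [ae_restrict_mem measurableSet_Ioc] with y hy
    have hy0 : 0 < y := hy.1
    refine hle _ y hy0 ?_
    rw [Real.norm_of_nonneg (by positivity)]
    exact min_le_left _ _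
  · have hi : IntegrableOn (fun y : ℝ ↦ y ^ ((N : ℝ) - 1 - ((N : ℝ) - 1) / 2 * r))
        (Set.Ioi 1) := integrableOn_Ioi_rpow_of_lt (by nlinarith) one_pos
    refine hi.mono' hfm.aestronglyMeasurable ?_
    filter_upwards [ae_restrict_mem measurableSet_Ioi] with y hy
    have hy0 : 0 < y := zero_lt_one.trans hy
    refine hle _ y hy0 ?_
    rw [Real.norm_of_nonneg (by positivity)]
    exact min_le_right _ _

/-- For radial functions `‖u‖_r² ≤ C q_{δ²}(u) / δ`, where `2N / (N - 1) < r < 2N / (N - 2)`. -/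
theorem exists_radial_eLpNorm_le {N : ℕ} (hN : 2 ≤ N) {r : ℝ} (hr : 0 < r)
    (hr1 : 2 * (N : ℝ) < r * ((N : ℝ) - 1)) (hr2 : r * ((N : ℝ) - 2) < 2 * (N : ℝ)) :
    ∃ C : ℝ, 0 < C ∧ ∀ (δ : ℝ) (u : L2 N), 0 < δ → δ ≤ 1 → u ∈ H2 N → IsRadial u →
      MemLp u (ENNReal.ofReal r) ∧
      (eLpNorm u (ENNReal.ofReal r) volume).toReal ≤ C * √(q (δ ^ 2) u / δ) := by
  obtain ⟨C, hC, h⟩ := exists_radial_pointwise_bound hN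
  have hW := memLp_min_rpow hN hr hr1 hr2
  set W : Space N → ℝ := fun x ↦
    min (‖x‖ ^ (-(((N : ℝ) - 2) / 2))) (‖x‖ ^ (-(((N : ℝ) - 1) / 2))) with hWdef
  refine ⟨C * ((eLpNorm W (ENNReal.ofReal r) volume).toReal + 1), by positivity, ?_⟩
  intro δ u hδ hδ1 hu hrad
  have hb : ∀ᵐ x : Space N, ‖u x‖ ≤ (C * √(q (δ ^ 2) u / δ)) * ‖W x‖ := by
    filter_upwards [h δ (((N : ℝ) - 2) / 2) u hδ hδ1 (by linarith) (by linarith) hu hrad,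
      h δ (((N : ℝ) - 1) / 2) u hδ hδ1 (by linarith) (by linarith) hu hrad] with x h1 h2
    have hWn : 0 ≤ W x := by simp only [hWdef]; positivity
    rw [Real.norm_of_nonneg hWn]
    simp only [hWdef]
    rw [mul_min_of_nonneg _ _ (by positivity)]
    exact le_min h1 h2
  have hmem : MemLp u (ENNReal.ofReal r) := hW.of_le_mul (Lp.aestronglyMeasurable u) hb
  refine ⟨hmem, ?_⟩
  have h3 := eLpNorm_le_mul_eLpNorm_of_ae_le_mul hb (ENNReal.ofReal r)
  have h4 := ENNReal.toReal_mono (ENNReal.mul_ne_top ENNReal.ofReal_ne_top hW.2.ne) h3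
  rw [ENNReal.toReal_mul, ENNReal.toReal_ofReal (by positivity)] at h4
  refine h4.trans ?_
  nlinarith [mul_nonneg hC.le (Real.sqrt_nonneg (q (δ ^ 2) u / δ))]

/-- Interpolation between `L²` and `Lʳ`, by splitting at the height `l`. -/
theorem integral_rpow_le_split {N : ℕ} {p r l : ℝ} (hp : 2 < p) (hpr : p ≤ r) (hl : 0 < l)
    (u : L2 N) (hu : MemLp u (ENNReal.ofReal r)) :
    MemLp u (ENNReal.ofReal p) ∧
      ∫ x, ‖u x‖ ^ p ≤ l ^ (p - 2) * ‖u‖ ^ 2 + l ^ (p - r) * ∫ x, ‖u x‖ ^ r := by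
  have hle : ∀ s : ℝ, 0 ≤ s → s ^ p ≤ l ^ (p - 2) * s ^ 2 + l ^ (p - r) * s ^ r := by
    intro s hs
    rcases hs.eq_or_lt with rfl | hs
    · rw [Real.zero_rpow (by linarith), Real.zero_rpow (by linarith)]
      simp
    rcases le_total s l with h | h
    · have h1 : s ^ p = s ^ (p - 2) * s ^ 2 := by
        rw [← Real.rpow_natCast, ← Real.rpow_add hs]; congr 1; push_cast; ring
      have h2 : s ^ (p - 2) ≤ l ^ (p - 2) := by gcongr
      have h3 : 0 ≤ l ^ (p - r) * s ^ r := by positivity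
      rw [h1]
      nlinarith [sq_nonneg s]
    · have h1 : s ^ p = s ^ (p - r) * s ^ r := by
        rw [← Real.rpow_add hs]; congr 1; ring
      have h2 : s ^ (p - r) ≤ l ^ (p - r) :=
        Real.rpow_le_rpow_of_nonpos hl h (by linarith)
      have h3 : 0 ≤ l ^ (p - 2) * s ^ 2 := by positivity
      have h4 : 0 ≤ s ^ r := by positivity
      rw [h1]
      nlinarith
  have hir := (memLp_ofReal_iff (by linarith) (Lp.aestronglyMeasurable u)).1 hu
  have hi := ((integrable_norm_sq u).const_mul (l ^ (p - 2))).add (hir.const_mul (l ^ (p - r)))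
  have hip : Integrable fun x ↦ ‖u x‖ ^ p := by
    refine hi.mono' ((Lp.aestronglyMeasurable u).norm.aemeasurable.pow_const p).aestronglyMeasurable
      (.of_forall fun x ↦ ?_)
    rw [Real.norm_of_nonneg (by positivity)]
    exact hle _ (norm_nonneg _)
  refine ⟨(memLp_ofReal_iff (by linarith) (Lp.aestronglyMeasurable u)).2 hip, ?_⟩
  calc ∫ x, ‖u x‖ ^ p ≤ ∫ x, (l ^ (p - 2) * ‖u x‖ ^ 2 + l ^ (p - r) * ‖u x‖ ^ r) :=
        integral_mono hip hi fun x ↦ hle _ (norm_nonneg _)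
    _ = _ := by
      rw [integral_add ((integrable_norm_sq u).const_mul _) (hir.const_mul _), integral_const_mul,
        integral_const_mul, integral_norm_sq]

theorem eLpNorm_toReal_pos {N : ℕ} {p : ℝ} (hp : 0 < p) {u : L2 N} (hu : u ≠ 0)
    (h : MemLp u (ENNReal.ofReal p)) : 0 < (eLpNorm u (ENNReal.ofReal p) volume).toReal := by
  refine ENNReal.toReal_pos ?_ h.2.ne
  rw [Ne, eLpNorm_eq_zero_iff h.1 (by simpa using hp), ← Lp.eq_zero_iff_ae_eq_zero]
  exact hu

theorem mul_norm_sq_le_q {N : ℕ} (ε : ℝ) {u : L2 N} (hu : u ∈ H2 N) : ε * ‖u‖ ^ 2 ≤ q ε u := by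
  rw [q_eq_norm_sq ε hu]
  nlinarith [sq_nonneg ‖weakLaplacian u + u‖]

/-- Lower bound for the radial quotient: the exponent interpolates between `q_{δ²}(u) ≥ δ² ‖u‖²` and
`q_{δ²}(u) ≥ c δ ‖u‖_r²`. -/
theorem exists_radial_quotient_ge {N : ℕ} (hN : 2 ≤ N) {p r : ℝ} (hp : 2 < p) (hpr : p ≤ r)
    (hr1 : 2 * (N : ℝ) < r * ((N : ℝ) - 1)) (hr2 : r * ((N : ℝ) - 2) < 2 * (N : ℝ)) :
    ∃ c : ℝ, 0 < c ∧ ∀ (δ : ℝ) (u : L2 N), 0 < δ → δ ≤ 1 → u ∈ H2 N → IsRadial u → u ≠ 0 →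
      c * δ ^ ((2 + (r - 4) / (2 * (r - 2)) * (p - 2)) * (2 / p)) ≤ quotient (δ ^ 2) p u := by
  obtain ⟨C, hC, h⟩ := exists_radial_eLpNorm_le hN (by linarith : 0 < r) hr1 hr2
  have hp0 : 0 < p := by linarith
  have hr0 : 0 < r := by linarith
  set κ := (r - 4) / (2 * (r - 2)) with hκ
  set γ := 2 + κ * (p - 2) with hγ
  refine ⟨((1 + C ^ r) ^ (2 / p))⁻¹, by positivity, fun δ u hδ hδ1 hu hrad hne ↦ ?_⟩
  obtain ⟨hmem, hle⟩ := h δ u hδ hδ1 hu hrad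
  have hun : 0 < ‖u‖ := norm_pos_iff.2 hne
  have hqu := mul_norm_sq_le_q (δ ^ 2) hu
  have hq : 0 < q (δ ^ 2) u := lt_of_lt_of_le (by positivity) hqu
  set Q := √(q (δ ^ 2) u) with hQ
  have hQ0 : 0 < Q := Real.sqrt_pos.2 hq
  have hQ2 : Q ^ 2 = q (δ ^ 2) u := Real.sq_sqrt hq.le
  obtain ⟨hmemp, hint⟩ := integral_rpow_le_split hp hpr (l := Q * δ ^ (-κ)) (by positivity) u hmem
  rw [← toReal_eLpNorm_rpow hr0 hmem, ← toReal_eLpNorm_rpow hp0 hmemp] at hint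
  set n := (eLpNorm u (ENNReal.ofReal p) volume).toReal with hn
  have hn0 : 0 < n := eLpNorm_toReal_pos hp0 hne hmemp
  have h1 : (Q * δ ^ (-κ)) ^ (p - 2) * ‖u‖ ^ 2 ≤ Q ^ p * δ ^ (-γ) := by
    have h2 : ‖u‖ ^ 2 ≤ Q ^ (2 : ℝ) * δ ^ (-2 : ℝ) := by
      rw [Real.rpow_neg hδ.le, Real.rpow_two, Real.rpow_two, hQ2, ← div_eq_mul_inv,
        le_div_iff₀ (by positivity)]
      linarith
    calc _ ≤ (Q * δ ^ (-κ)) ^ (p - 2) * (Q ^ (2 : ℝ) * δ ^ (-2 : ℝ)) := by gcongr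
      _ = (Q ^ (p - 2) * Q ^ (2 : ℝ)) * (δ ^ (-κ * (p - 2)) * δ ^ (-2 : ℝ)) := by
        rw [Real.mul_rpow hQ0.le (by positivity), ← Real.rpow_mul hδ.le]; ring
      _ = _ := by
        rw [← Real.rpow_add hQ0, ← Real.rpow_add hδ]
        congr 2 <;> (try rw [hγ]) <;> ring
  have h3 : (Q * δ ^ (-κ)) ^ (p - r) * (eLpNorm u (ENNReal.ofReal r) volume).toReal ^ r ≤
      C ^ r * (Q ^ p * δ ^ (-γ)) := by
    have h4 : √(q (δ ^ 2) u / δ) = Q * δ ^ (-(1 / 2) : ℝ) := by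
      rw [Real.sqrt_div hq.le, Real.rpow_neg hδ.le, Real.sqrt_eq_rpow δ, div_eq_mul_inv]
    rw [h4] at hle
    calc _ ≤ (Q * δ ^ (-κ)) ^ (p - r) * (C * (Q * δ ^ (-(1 / 2) : ℝ))) ^ r := by gcongr
      _ = C ^ r * ((Q ^ (p - r) * Q ^ r) * (δ ^ (-κ * (p - r)) * δ ^ (-(1 / 2) * r))) := by
        rw [Real.mul_rpow hQ0.le (by positivity), Real.mul_rpow hC.le (by positivity),
          Real.mul_rpow hQ0.le (by positivity), ← Real.rpow_mul hδ.le, ← Real.rpow_mul hδ.le]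
        ring
      _ = _ := by
        rw [← Real.rpow_add hQ0, ← Real.rpow_add hδ]
        congr 3
        · ring
        · -- the choice of `κ` gives both terms of the splitting the same power of `δ`
          have hr2' : r - 2 ≠ 0 := by linarith
          rw [hγ, hκ]
          field_simp
          ring
  have h5 : n ^ p ≤ (1 + C ^ r) * (Q ^ p * δ ^ (-γ)) := by linarith
  have h6 : n ^ 2 ≤ (1 + C ^ r) ^ (2 / p) * (Q ^ 2 * δ ^ (-(γ * (2 / p)))) := by
    have h7 : (n ^ p) ^ (2 / p) ≤ ((1 + C ^ r) * (Q ^ p * δ ^ (-γ))) ^ (2 / p) := by gcongr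
    rw [Real.mul_rpow (by positivity) (by positivity), Real.mul_rpow (by positivity)
      (by positivity), ← Real.rpow_mul hn0.le, ← Real.rpow_mul hQ0.le, ← Real.rpow_mul hδ.le,
      mul_div_cancel₀ _ hp0.ne', Real.rpow_two, Real.rpow_two, neg_mul] at h7
    exact h7
  rw [quotient, ← hn, ← hQ2, le_div_iff₀ (by positivity)]
  calc ((1 + C ^ r) ^ (2 / p))⁻¹ * δ ^ (γ * (2 / p)) * n ^ 2
      ≤ ((1 + C ^ r) ^ (2 / p))⁻¹ * δ ^ (γ * (2 / p)) *
        ((1 + C ^ r) ^ (2 / p) * (Q ^ 2 * δ ^ (-(γ * (2 / p))))) := by gcongr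
    _ = Q ^ 2 := by
      have h8 : 0 < 1 + C ^ r := by positivity
      have h9 : δ ^ (γ * (2 / p)) * δ ^ (-(γ * (2 / p))) = 1 := by
        rw [← Real.rpow_add hδ]; simp
      have h10 : (1 + C ^ r) ^ (2 / p) ≠ 0 := (Real.rpow_pos_of_pos h8 _).ne'
      linear_combination (Q ^ 2 * δ ^ (γ * (2 / p)) * δ ^ (-(γ * (2 / p)))) *
        inv_mul_cancel₀ h10 + Q ^ 2 * h9

/-! ### Nonradial wave packets -/

theorem hasTemperateGrowth_cexp_I_mul :
    (fun t : ℝ ↦ Complex.exp (Complex.I * t)).HasTemperateGrowth := by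
  have hd : ∀ n : ℕ, iteratedDeriv n (fun t : ℝ ↦ Complex.exp (Complex.I * t)) =
      fun t : ℝ ↦ Complex.I ^ n * Complex.exp (Complex.I * t) := by
    intro n
    induction n with
    | zero => simp
    | succ n ih =>
      rw [iteratedDeriv_succ, ih]
      ext t
      have h1 : HasDerivAt (fun t : ℝ ↦ Complex.I * (t : ℂ)) Complex.I t := by
        simpa using ((hasDerivAt_id t).ofReal_comp).const_mul Complex.I
      rw [(h1.cexp.const_mul (Complex.I ^ n)).deriv]
      ring
  refine ⟨(contDiff_const.mul Complex.ofRealCLM.contDiff).cexp, fun n ↦ ⟨0, 1, fun t ↦ ?_⟩⟩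
  rw [norm_iteratedFDeriv_eq_norm_iteratedDeriv, hd]
  simp only [norm_mul, norm_pow, Complex.norm_I, one_pow, one_mul, pow_zero]
  rw [mul_comm, Complex.norm_exp_ofReal_mul_I]

/-- The diagonal scaling `x ↦ (sᵢ xᵢ)ᵢ`. -/
noncomputable def scaling {N : ℕ} (s : Fin N → ℝ) (hs : ∀ i, s i ≠ 0) : Space N ≃L[ℝ] Space N :=
  LinearEquiv.toContinuousLinearEquiv
    { Matrix.toLpLin 2 2 (Matrix.diagonal s) with
      invFun := Matrix.toLpLin 2 2 (Matrix.diagonal fun i ↦ (s i)⁻¹)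
      left_inv := fun x ↦ by ext i; simp [Matrix.mulVec_diagonal, hs i]
      right_inv := fun x ↦ by ext i; simp [Matrix.mulVec_diagonal, hs i] }

@[simp]
theorem scaling_apply {N : ℕ} (s : Fin N → ℝ) (hs : ∀ i, s i ≠ 0) (x : Space N) (i : Fin N) :
    scaling s hs x i = s i * x i := by
  simp [scaling, Matrix.mulVec_diagonal]

theorem scaling_single {N : ℕ} (s : Fin N → ℝ) (hs : ∀ i, s i ≠ 0) (i : Fin N) :
    scaling s hs (EuclideanSpace.single i 1) = s i • EuclideanSpace.single i 1 := by
  ext j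
  rcases eq_or_ne j i with rfl | h <;> simp [*]

theorem map_scaling_volume {N : ℕ} (s : Fin N → ℝ) (hs : ∀ i, s i ≠ 0) :
    (volume : Measure (Space N)).map (scaling s hs) = ENNReal.ofReal |(∏ i, s i)⁻¹| • volume := by
  have h : LinearMap.det ((scaling s hs : Space N →L[ℝ] Space N) : Space N →ₗ[ℝ] Space N) =
      ∏ i, s i := by
    have : ((scaling s hs : Space N →L[ℝ] Space N) : Space N →ₗ[ℝ] Space N) =
      Matrix.toLpLin 2 2 (Matrix.diagonal s) := rfl
    rw [this, Matrix.toLpLin_eq_toLin, LinearMap.det_toLin, Matrix.det_diagonal]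
  have h2 := Measure.map_linearMap_addHaar_eq_smul_addHaar (volume : Measure (Space N))
    (f := ((scaling s hs : Space N →L[ℝ] Space N) : Space N →ₗ[ℝ] Space N))
    (by rw [h]; exact Finset.prod_ne_zero_iff.2 fun i _ ↦ hs i)
  rw [h] at h2
  exact h2

/-- The wave packet `x ↦ exp (i x_k) φ(s₁ x₁, …, s_N x_N)`. -/
noncomputable def wavePacket {N : ℕ} (k : Fin N) (s : Fin N → ℝ) (hs : ∀ i, s i ≠ 0)
    (φ : 𝓢(Space N, ℂ)) : 𝓢(Space N, ℂ) :=
  SchwartzMap.smulLeftCLM ℂ (fun x : Space N ↦ Complex.exp (Complex.I * (x k : ℝ)))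
    (SchwartzMap.compCLMOfContinuousLinearEquiv ℂ (scaling s hs) φ)

section wavePacket

variable {N : ℕ} (k : Fin N) (s : Fin N → ℝ) (hs : ∀ i, s i ≠ 0) (φ : 𝓢(Space N, ℂ))

theorem wavePacket_apply (x : Space N) :
    wavePacket k s hs φ x = Complex.exp (Complex.I * (x k : ℝ)) * φ (scaling s hs x) := by
  have h : (fun x : Space N ↦ Complex.exp (Complex.I * (x k : ℝ))).HasTemperateGrowth :=
    hasTemperateGrowth_cexp_I_mul.comp (EuclideanSpace.proj (𝕜 := ℝ) k).hasTemperateGrowth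
  rw [wavePacket, SchwartzMap.smulLeftCLM_apply_apply h]
  rfl

theorem lineDerivOp_wavePacket (i : Fin N) :
    ∂_{EuclideanSpace.single i (1 : ℝ)} (wavePacket k s hs φ) =
      wavePacket k s hs ((if i = k then Complex.I else 0) • φ +
        (s i : ℂ) • ∂_{EuclideanSpace.single i (1 : ℝ)} φ) := by
  ext x
  set m : Space N := EuclideanSpace.single i (1 : ℝ)
  have hD : ∀ t : ℝ, scaling s hs (x + t • m) = scaling s hs x + t • (s i • m) := fun t ↦ by
    rw [map_add, map_smul, scaling_single]
  have h1 : HasDerivAt (fun t : ℝ ↦ φ (scaling s hs (x + t • m)))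
      ((s i : ℂ) * (∂_{m} φ) (scaling s hs x)) 0 := by
    have h2 : HasDerivAt (fun t : ℝ ↦ scaling s hs x + t • (s i • m)) (s i • m) 0 := by
      simpa using ((hasDerivAt_id (0 : ℝ)).smul_const (s i • m)).const_add (scaling s hs x)
    have h3 := (φ.hasFDerivAt (scaling s hs x + (0 : ℝ) • (s i • m))).comp_hasDerivAt (0 : ℝ) h2
    simp only [zero_smul, add_zero, map_smul] at h3
    rw [SchwartzMap.lineDerivOp_apply_eq_fderiv]
    simp only [hD]
    simpa [Function.comp_def] using h3
  have h4 : HasDerivAt (fun t : ℝ ↦ Complex.exp (Complex.I * ((x + t • m) k : ℝ)))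
      ((if i = k then Complex.I else 0) * Complex.exp (Complex.I * (x k : ℝ))) 0 := by
    have h5 : HasDerivAt (fun t : ℝ ↦ Complex.I * ((x + t • m) k : ℝ))
        (if i = k then Complex.I else 0) 0 := by
      have h6 : HasDerivAt (fun t : ℝ ↦ (x + t • m) k) (m k) 0 := by
        simpa using ((hasDerivAt_id (0 : ℝ)).mul_const (m k)).const_add (x k)
      refine (h6.ofReal_comp.const_mul Complex.I).congr_deriv ?_
      by_cases h : i = k
      · subst h; simp [m]
      · simp [m, h, Ne.symm h]
    have h7 := h5.cexp
    simpa [mul_comm] using h7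
  have h8 := h4.mul h1
  rw [SchwartzMap.lineDerivOp_apply, lineDeriv]
  have h9 : (fun t : ℝ ↦ wavePacket k s hs φ (x + t • m)) =
      (fun t : ℝ ↦ Complex.exp (Complex.I * ((x + t • m) k : ℝ))) *
        fun t ↦ φ (scaling s hs (x + t • m)) := by
    ext t; rw [wavePacket_apply]; rfl
  rw [h9, h8.deriv, wavePacket_apply]
  simp only [zero_smul, add_zero, FunLike.coe_add, FunLike.coe_smul, Pi.add_apply, Pi.smul_apply,
    smul_eq_mul]
  ring

theorem wavePacket_add (ψ : 𝓢(Space N, ℂ)) :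
    wavePacket k s hs (φ + ψ) = wavePacket k s hs φ + wavePacket k s hs ψ := by
  simp [wavePacket]

theorem wavePacket_sum {ι : Type*} (t : Finset ι) (ψ : ι → 𝓢(Space N, ℂ)) :
    wavePacket k s hs (∑ i ∈ t, ψ i) = ∑ i ∈ t, wavePacket k s hs (ψ i) := by
  simp [wavePacket]

/-- On a wave packet `Δ + 1` only produces terms with at least one factor `s_k` or two factors
`s_i`, since `exp (i x_k)` solves the Helmholtz equation. -/
theorem laplacian_add_wavePacket :
    Δ (wavePacket k s hs φ) + wavePacket k s hs φ = wavePacket k s hs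
      ((2 * Complex.I * s k) • ∂_{EuclideanSpace.single k (1 : ℝ)} φ +
        ∑ i, ((s i : ℂ) ^ 2) • ∂_{EuclideanSpace.single i (1 : ℝ)}
          (∂_{EuclideanSpace.single i (1 : ℝ)} φ)) := by
  rw [SchwartzMap.laplacian_eq_sum (EuclideanSpace.basisFun (Fin N) ℝ)]
  have h1 : ∀ i, ∂_{EuclideanSpace.basisFun (Fin N) ℝ i}
      (∂_{EuclideanSpace.basisFun (Fin N) ℝ i} (wavePacket k s hs φ)) = wavePacket k s hs
      ((if i = k then -φ + (2 * Complex.I * s k) • ∂_{EuclideanSpace.single k (1 : ℝ)} φ else 0) +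
        ((s i : ℂ) ^ 2) • ∂_{EuclideanSpace.single i (1 : ℝ)}
          (∂_{EuclideanSpace.single i (1 : ℝ)} φ)) := by
    intro i
    rw [EuclideanSpace.basisFun_apply, lineDerivOp_wavePacket, lineDerivOp_wavePacket]
    congr 1
    rw [LineDeriv.lineDerivOp_add, LineDeriv.lineDerivOp_smul, LineDeriv.lineDerivOp_smul]
    by_cases h : i = k
    · subst h
      ext x
      simp
      linear_combination φ x * Complex.I_sq
    · ext x
      simp [h]
      ring
  simp only [h1]
  rw [← wavePacket_sum, ← wavePacket_add]
  congr 1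
  rw [Finset.sum_add_distrib, Finset.sum_ite_eq' Finset.univ k]
  simp
  abel

theorem eLpNorm_wavePacket (p : ℝ≥0∞) (hp : p ≠ ⊤) :
    eLpNorm (wavePacket k s hs φ) p volume =
      ENNReal.ofReal |(∏ i, s i)⁻¹| ^ (1 / p).toReal * eLpNorm φ p volume := by
  have h1 : eLpNorm (wavePacket k s hs φ) p volume = eLpNorm (φ ∘ scaling s hs) p volume := by
    refine eLpNorm_congr_norm_ae (.of_forall fun x ↦ ?_)
    rw [wavePacket_apply, norm_mul, mul_comm Complex.I, Complex.norm_exp_ofReal_mul_I, one_mul]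
    rfl
  rw [h1, ← eLpNorm_map_measure (by exact φ.continuous.aestronglyMeasurable)
    (scaling s hs).continuous.measurable.aemeasurable, map_scaling_volume,
    eLpNorm_smul_measure_of_ne_top hp, smul_eq_mul]

end wavePacket

theorem toLp_mem_H2 {N : ℕ} (φ : 𝓢(Space N, ℂ)) : φ.toLp 2 volume ∈ H2 N := by
  change MemSobolev 2 2 ((φ.toLp 2 volume : L2 N) : 𝓢'(Space N, ℂ))
  rw [Lp.toTemperedDistribution_toLp_eq]
  exact φ.memSobolev

theorem weakLaplacian_toLp {N : ℕ} (φ : 𝓢(Space N, ℂ)) :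
    weakLaplacian (φ.toLp 2 volume) = (Δ φ).toLp 2 volume := by
  rw [weakLaplacian, Lp.toTemperedDistribution_toLp_eq,
    TemperedDistribution.laplacian_toTemperedDistributionCLM_eq,
    ← Lp.toTemperedDistribution_toLp_eq (p := 2), repr_coe]

/-! ### Comparison of the two infima -/

/-- There are nonzero radial Schwartz functions. -/
theorem exists_radial_schwartz (N : ℕ) :
    ∃ φ : 𝓢(Space N, ℂ), φ ≠ 0 ∧ ∃ f : ℝ → ℂ, ∀ x, φ x = f ‖x‖ := by
  let g : Space N → ℂ := fun x ↦ Complex.ofRealCLM (Real.smoothTransition (2 - ‖x‖ ^ 2))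
  have hg : ContDiff ℝ ∞ g := Complex.ofRealCLM.contDiff.comp
    (Real.smoothTransition.contDiff.comp (contDiff_const.sub (contDiff_norm_sq ℝ)))
  have hc : HasCompactSupport g := by
    refine HasCompactSupport.intro (isCompact_closedBall 0 2) fun x hx ↦ ?_
    have h2 : 2 < ‖x‖ := by simpa using hx
    simp only [g]
    rw [Real.smoothTransition.zero_of_nonpos (by nlinarith), map_zero]
  refine ⟨hc.toSchwartzMap hg, fun h ↦ ?_, fun t ↦ Real.smoothTransition (2 - t ^ 2), fun x ↦ rfl⟩
  have h0 : g 0 = 0 := congrArg (fun φ : 𝓢(Space N, ℂ) ↦ φ 0) h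
  simp only [g, norm_zero] at h0
  rw [Real.smoothTransition.one_of_one_le (by norm_num)] at h0
  simp at h0

theorem toLp_ne_zero {N : ℕ} {φ : 𝓢(Space N, ℂ)} (hφ : φ ≠ 0) : φ.toLp 2 volume ≠ 0 := by
  intro h
  exact hφ (SchwartzMap.injective_toLp 2 volume (h.trans (map_zero
    (SchwartzMap.toLpCLM ℂ (E := Space N) ℂ 2 volume)).symm))

/-- Upper bound for the quotient by a wave packet of length `δ⁻¹` in the direction of oscillation
and width `δ ^ (-1 / 2)` in the others. -/
theorem exists_quotient_le {N : ℕ} (hN : 2 ≤ N) {p : ℝ} (hp : 2 < p) :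
    ∃ C : ℝ, 0 < C ∧ ∀ δ : ℝ, 0 < δ → δ ≤ 1 → ∃ u : L2 N, u ∈ H2 N ∧ u ≠ 0 ∧
      quotient (δ ^ 2) p u ≤ C * δ ^ (2 - ((N : ℝ) + 1) * (1 / 2 - 1 / p)) := by
  obtain ⟨φ, hφ, -⟩ := exists_radial_schwartz N
  have hp0 : 0 < p := by linarith
  let k : Fin N := ⟨0, by omega⟩
  let e : Fin N → Space N := fun i ↦ EuclideanSpace.single i 1
  obtain ⟨A, hAφ⟩ : ∃ A : ℝ, ‖φ.toLp 2 volume‖ = A := ⟨_, rfl⟩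
  obtain ⟨B, hB⟩ : ∃ B : ℝ, 2 * ‖(∂_{e k} φ).toLp 2 volume‖ +
      ∑ i, ‖(∂_{e i} (∂_{e i} φ)).toLp 2 volume‖ = B := ⟨_, rfl⟩
  obtain ⟨n, hnφ⟩ : ∃ n : ℝ, (eLpNorm φ (ENNReal.ofReal p) volume).toReal = n := ⟨_, rfl⟩
  have hA : 0 < A := hAφ ▸ norm_pos_iff.2 (toLp_ne_zero hφ)
  have hn : 0 < n := by
    have h := φ.coeFn_toLp 2 volume
    have := eLpNorm_toReal_pos hp0 (toLp_ne_zero hφ) ((memLp_congr_ae h).2 (φ.memLp _))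
    rwa [eLpNorm_congr_ae h, hnφ] at this
  refine ⟨(B ^ 2 + A ^ 2) / n ^ 2, by positivity, fun δ hδ hδ1 ↦ ?_⟩
  let s : Fin N → ℝ := fun i ↦ if i = k then δ else √δ
  have hs0 : ∀ i, 0 < s i := fun i ↦ by simp only [s]; split_ifs <;> positivity
  have hs : ∀ i, s i ≠ 0 := fun i ↦ (hs0 i).ne'
  have hs2 : ∀ i, s i ^ 2 ≤ δ := fun i ↦ by
    simp only [s]
    split_ifs
    · nlinarith
    · rw [Real.sq_sqrt hδ.le]
  set d : ℝ := |(∏ i, s i)⁻¹| with hd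
  have hdδ : d = δ ^ (-(((N : ℝ) + 1) / 2)) := by
    have h1 : ∏ i, s i = δ ^ (((N : ℝ) + 1) / 2) := by
      have h2 : ∏ i ∈ Finset.univ.erase k, s i = √δ ^ (N - 1) := by
        rw [Finset.prod_congr rfl (g := fun _ ↦ √δ)
          (fun i hi ↦ by simp [s, Finset.ne_of_mem_erase hi]), Finset.prod_const,
          Finset.card_erase_of_mem (Finset.mem_univ _), Finset.card_univ, Fintype.card_fin]
      rw [← Finset.mul_prod_erase _ _ (Finset.mem_univ k), h2]
      have h3 : s k = δ ^ (1 : ℝ) := by simp [s]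
      rw [h3, Real.sqrt_eq_rpow, ← Real.rpow_natCast, ← Real.rpow_mul hδ.le,
        ← Real.rpow_add hδ, Nat.cast_sub (by omega)]
      congr 1
      push_cast
      ring
    rw [hd, h1, abs_of_pos (by positivity), Real.rpow_neg hδ.le]
  have hd0 : 0 < d := by rw [hdδ]; positivity
  have hnorm : ∀ ψ : 𝓢(Space N, ℂ), ‖(wavePacket k s hs ψ).toLp 2 volume‖ ^ 2 =
      d * ‖ψ.toLp 2 volume‖ ^ 2 := by
    intro ψ
    rw [SchwartzMap.norm_toLp, SchwartzMap.norm_toLp, eLpNorm_wavePacket k s hs ψ 2 (by norm_num),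
      ENNReal.toReal_mul, mul_pow, ← ENNReal.toReal_rpow, ENNReal.toReal_ofReal hd0.le,
      ← Real.rpow_mul_natCast hd0.le]
    norm_num
  set W := wavePacket k s hs φ
  set ψ : 𝓢(Space N, ℂ) := (2 * Complex.I * s k) • ∂_{e k} φ +
    ∑ i, ((s i : ℂ) ^ 2) • ∂_{e i} (∂_{e i} φ)
  have hψ : ‖ψ.toLp 2 volume‖ ≤ δ * B := by
    have h1 : ψ.toLp 2 volume = (2 * Complex.I * s k) • (∂_{e k} φ).toLp 2 volume +
        ∑ i, ((s i : ℂ) ^ 2) • (∂_{e i} (∂_{e i} φ)).toLp 2 volume := by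
      simp only [← SchwartzMap.toLpCLM_apply (𝕜 := ℂ), ψ, map_add, map_smul, map_sum]
    rw [h1]
    refine (norm_add_le _ _).trans ?_
    rw [← hB, mul_add, Finset.mul_sum]
    refine add_le_add ?_ ((norm_sum_le _ _).trans (Finset.sum_le_sum fun i _ ↦ ?_))
    · rw [norm_smul]
      have : s k = δ := by simp [s]
      rw [this, norm_mul, norm_mul, Complex.norm_I, Complex.norm_real, Real.norm_of_nonneg hδ.le]
      norm_num
      linarith
    · rw [norm_smul, norm_pow, Complex.norm_real, Real.norm_of_nonneg (hs0 i).le]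
      gcongr
      exact hs2 i
  have hW2 : ‖W.toLp 2 volume‖ ^ 2 = d * A ^ 2 := by rw [hnorm φ, hAφ]
  have hq : q (δ ^ 2) (W.toLp 2 volume) = d * ‖ψ.toLp 2 volume‖ ^ 2 + δ ^ 2 * (d * A ^ 2) := by
    rw [q_eq_norm_sq _ (toLp_mem_H2 W), weakLaplacian_toLp, hW2, ← hnorm ψ]
    congr 3
    rw [← laplacian_add_wavePacket]
    exact (map_add (SchwartzMap.toLpCLM ℂ (E := Space N) ℂ 2 volume) (Δ W) W).symm
  have hWp : (eLpNorm (W.toLp 2 volume) (ENNReal.ofReal p) volume).toReal = d ^ (1 / p) * n := by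
    rw [eLpNorm_congr_ae (W.coeFn_toLp 2 volume),
      eLpNorm_wavePacket k s hs φ _ ENNReal.ofReal_ne_top, ENNReal.toReal_mul,
      ← ENNReal.toReal_rpow, ENNReal.toReal_ofReal hd0.le, ENNReal.toReal_div, ENNReal.toReal_one,
      ENNReal.toReal_ofReal hp0.le, hnφ]
  refine ⟨W.toLp 2 volume, toLp_mem_H2 W, ?_, ?_⟩
  · intro h
    rw [h, norm_zero] at hW2
    have : 0 < d * A ^ 2 := by positivity
    norm_num at hW2
    rcases hW2 with h | h <;> linarith
  · rw [quotient, hWp, hq]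
    have h1 : δ ^ (2 - ((N : ℝ) + 1) * (1 / 2 - 1 / p)) = δ ^ 2 * d / (d ^ (1 / p)) ^ 2 := by
      rw [hdδ, ← Real.rpow_mul hδ.le, ← Real.rpow_mul_natCast hδ.le, ← Real.rpow_natCast δ 2,
        ← Real.rpow_add hδ, ← Real.rpow_sub hδ]
      congr 1
      push_cast
      ring
    have h2 : d * ‖ψ.toLp 2 volume‖ ^ 2 + δ ^ 2 * (d * A ^ 2) ≤
        δ ^ 2 * d * (B ^ 2 + A ^ 2) := by
      have h3 : ‖ψ.toLp 2 volume‖ ^ 2 ≤ (δ * B) ^ 2 := by gcongr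
      nlinarith
    rw [h1]
    calc _ ≤ δ ^ 2 * d * (B ^ 2 + A ^ 2) / (d ^ (1 / p) * n) ^ 2 := by gcongr
      _ = _ := by
        have : 0 < d ^ (1 / p) := by positivity
        field_simp

theorem quotient_nonneg {N : ℕ} {ε p : ℝ} (hε : 0 ≤ ε) {u : L2 N} (hu : u ∈ H2 N) :
    0 ≤ quotient ε p u :=
  div_nonneg (q_nonneg hε hu) (sq_nonneg _)

theorem R_le_quotient {N : ℕ} {ε p : ℝ} (hε : 0 ≤ ε) {u : L2 N} (hu : u ∈ H2 N) (hne : u ≠ 0) :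
    R N ε p ≤ quotient ε p u :=
  csInf_le ⟨0, by rintro _ ⟨v, hv, -, rfl⟩; exact quotient_nonneg hε hv⟩ ⟨u, hu, hne, rfl⟩

theorem Rrad_le_quotient {N : ℕ} {ε p : ℝ} (hε : 0 ≤ ε) {u : L2 N} (hu : u ∈ H2 N)
    (hrad : IsRadial u) (hne : u ≠ 0) : Rrad N ε p ≤ quotient ε p u :=
  csInf_le ⟨0, by rintro _ ⟨v, hv, -, -, rfl⟩; exact quotient_nonneg hε hv⟩
    ⟨u, hu, hrad, hne, rfl⟩

theorem le_Rrad {N : ℕ} {ε p c : ℝ}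
    (h : ∀ u : L2 N, u ∈ H2 N → IsRadial u → u ≠ 0 → c ≤ quotient ε p u) : c ≤ Rrad N ε p := by
  refine le_csInf ?_ ?_
  · obtain ⟨φ, hφ, f, hf⟩ := exists_radial_schwartz N
    refine ⟨_, φ.toLp 2 volume, toLp_mem_H2 φ, ⟨f, ?_⟩, toLp_ne_zero hφ, rfl⟩
    filter_upwards [φ.coeFn_toLp 2 volume] with x hx
    rw [hx, hf]
  · rintro _ ⟨u, hu, hrad, hne, rfl⟩
    exact h u hu hrad hne

/-- The exponent of the radial lower bound is smaller than that of the wave packets as soon as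
`r < 2(N + 1) / (N - 1)`. -/
theorem radial_exponent_lt {N p r : ℝ} (hp : 2 < p) (hr : 2 < r)
    (h : r * (N - 1) < 2 * N + 2) :
    (2 + (r - 4) / (2 * (r - 2)) * (p - 2)) * (2 / p) < 2 - (N + 1) * (1 / 2 - 1 / p) := by
  have hr2 : 0 < r - 2 := by linarith
  have hp2 : 0 < p - 2 := by linarith
  have hp0 : 0 < p := by linarith
  have h1 : 2 - (N + 1) * (1 / 2 - 1 / p) - (2 + (r - 4) / (2 * (r - 2)) * (p - 2)) * (2 / p) =
      (p - 2) * (2 * N + 2 - r * (N - 1)) / (2 * p * (r - 2)) := by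
    have := hr2.ne'
    field_simp
    ring
  have h2 : 0 < (p - 2) * (2 * N + 2 - r * (N - 1)) / (2 * p * (r - 2)) :=
    div_pos (mul_pos hp2 (by linarith)) (by positivity)
  linarith

theorem exists_R_lt_Rrad {N : ℕ} (hN : 2 ≤ N) {p : ℝ} (hp2 : 2 < p)
    (hp : p < (2 * (N : ℝ) + 2) / ((N : ℝ) - 1)) :
    ∃ ε₀ : ℝ, 0 < ε₀ ∧ ∀ ε : ℝ, 0 < ε → ε ≤ ε₀ → R N ε p < Rrad N ε p := by
  have hNr : (2 : ℝ) ≤ N := by exact_mod_cast hN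
  have hN1 : (0 : ℝ) < N - 1 := by linarith
  obtain ⟨r, hr1, hr2⟩ := exists_between (max_lt hp
    (show 2 * (N : ℝ) / ((N : ℝ) - 1) < (2 * (N : ℝ) + 2) / ((N : ℝ) - 1) by gcongr; linarith))
  obtain ⟨hpr, hr1⟩ := max_lt_iff.1 hr1
  rw [div_lt_iff₀ hN1] at hr1
  rw [lt_div_iff₀ hN1] at hr2
  have hr3 : r * ((N : ℝ) - 2) < 2 * (N : ℝ) := by
    have h1 : r * ((N : ℝ) - 1) * (N - 2) ≤ (2 * N + 2) * (N - 2) :=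
      mul_le_mul_of_nonneg_right hr2.le (by linarith)
    by_contra! h2
    nlinarith [mul_le_mul_of_nonneg_right h2 hN1.le]
  obtain ⟨c, hc, hlow⟩ := exists_radial_quotient_ge hN hp2 hpr.le hr1 hr3
  obtain ⟨C, hC, hupp⟩ := exists_quotient_le hN hp2
  have hexp := radial_exponent_lt (N := N) (p := p) (r := r) hp2 (by linarith) hr2
  set α := (2 + (r - 4) / (2 * (r - 2)) * (p - 2)) * (2 / p)
  set β := 2 - ((N : ℝ) + 1) * (1 / 2 - 1 / p)
  have hαβ : 0 < β - α := by linarith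
  set δ₀ := min 1 ((c / (2 * C)) ^ (β - α)⁻¹)
  have hδ₀ : 0 < δ₀ := by positivity
  refine ⟨δ₀ ^ 2, by positivity, fun ε hε hεle ↦ ?_⟩
  set δ := √ε
  have hδ : 0 < δ := Real.sqrt_pos.2 hε
  have hδε : δ ^ 2 = ε := Real.sq_sqrt hε.le
  have hδle : δ ≤ δ₀ := Real.sqrt_le_iff.2 ⟨hδ₀.le, hεle⟩
  have hδ1 : δ ≤ 1 := hδle.trans (min_le_left _ _)
  rw [← hδε]
  obtain ⟨u, hu, hne, hule⟩ := hupp δ hδ hδ1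
  have hgap : C * δ ^ β < c * δ ^ α := by
    have h1 : δ ^ (β - α) ≤ c / (2 * C) := by
      calc δ ^ (β - α) ≤ ((c / (2 * C)) ^ (β - α)⁻¹) ^ (β - α) := by
            gcongr
            exact hδle.trans (min_le_right _ _)
        _ = c / (2 * C) := by
            rw [← Real.rpow_mul (by positivity), inv_mul_cancel₀ hαβ.ne', Real.rpow_one]
    have h2 : δ ^ β = δ ^ (β - α) * δ ^ α := by rw [← Real.rpow_add hδ]; ring_nf
    have h3 : 0 < δ ^ α := by positivity
    calc C * δ ^ β = C * δ ^ (β - α) * δ ^ α := by rw [h2]; ring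
      _ ≤ C * (c / (2 * C)) * δ ^ α := by gcongr
      _ = c / 2 * δ ^ α := by field_simp
      _ < c * δ ^ α := by gcongr; linarith
  calc R N (δ ^ 2) p ≤ quotient (δ ^ 2) p u := R_le_quotient (by positivity) hu hne
    _ ≤ C * δ ^ β := hule
    _ < c * δ ^ α := hgap
    _ ≤ Rrad N (δ ^ 2) p := le_Rrad fun v hv hrad hvne ↦ hlow δ v hδ hδ1 hv hrad hvne

end BiharmonicNLS

theorem theorem2 (N : ℕ) (hN : 2 ≤ N) (p : ℝ) (hp2 : 2 < p)
    (hp : p < (2 * (N : ℝ) + 2) / ((N : ℝ) - 1)) :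
    ∃ ε₀ : ℝ, 0 < ε₀ ∧ ∀ ε : ℝ, 0 < ε → ε ≤ ε₀ →
      (∀ u : BiharmonicNLS.L2 N, BiharmonicNLS.IsGroundState ε p u →
        ¬ BiharmonicNLS.IsRadial u) ∧
      BiharmonicNLS.R N ε p < BiharmonicNLS.Rrad N ε p := by
  obtain ⟨ε₀, hε₀, h⟩ := BiharmonicNLS.exists_R_lt_Rrad hN hp2 hp
  refine ⟨ε₀, hε₀, fun ε hε hεle ↦ ⟨fun u ⟨hu, hne, _, hR⟩ hrad ↦ ?_, h ε hε hεle⟩⟩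
  have h1 := BiharmonicNLS.Rrad_le_quotient (p := p) hε.le hu hrad hne
  exact absurd (h ε hε hεle) (not_lt.2 (hR ▸ h1))
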